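/- Let $X$ be a compact Hausdorff space, let $n\in\mathbb{N}$, and let $A=M_n\otimes C(X)$ be the C*-algebra of $n\times n$ matrices over the algebra $C(X)$ of continuous complex-valued functions on $X$. Let $\phi$ be a state on $A$ with GNS representation $\pi_\phi$ on the Hilbert space $H_\phi$ and canonical cyclic vector $\xi_\phi$. Suppose that $\phi$ is GNS-faithful, i.e. that the vector state $S\mapsto\langle S\xi_\phi,\xi_\phi\rangle$ is faithful on the von Neumann algebra $\pi_\phi(A)''$: if $S\in\pi_\phi(A)''$ is positive and $\langle S\xi_\phi,\xi_\phi\rangle=0$, then $S=0$. Then $\phi$ is CP-approximable, i.e. there is a net $(T_\alpha)$ of finite-rank, unital, completely positive linear maps $T_\alpha:A\to A$ such that $\phi\circ T_\alpha=\phi$ for every $\alpha$ and $\Vert T_\alpha(a)-a\Vert\to 0$ for every $a\in A$. -/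

import Mathlib

open scoped ComplexOrder CStarAlgebra InnerProductSpace Topology

universe u

section StatesOnCStarAlgebras

variable {A : Type u} [CStarAlgebra A] [PartialOrder A] [StarOrderedRing A]

/-- A state on a unital C⋆-algebra: a positive linear functional taking the value `1` at `1`. -/
def IsState (φ : A →ₚ[ℂ] ℂ) : Prop := φ 1 = 1

/-- The cyclic vector of the GNS representation of `φ`: the class of `1` in the GNS space. -/
noncomputable def gnsVector (φ : A →ₚ[ℂ] ℂ) : φ.GNS :=
  ((φ.toPreGNS 1 : φ.PreGNS) : φ.GNS)

/-- The bicommutant `π_φ(A)''` of the image of the GNS representation, inside the bounded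
operators on the GNS space. -/
noncomputable def gnsBicommutant (φ : A →ₚ[ℂ] ℂ) : Set (φ.GNS →L[ℂ] φ.GNS) :=
  (Set.range φ.gnsStarAlgHom).centralizer.centralizer

/-- `φ` is GNS-faithful: the vector state of the GNS cyclic vector `ξ` is faithful on
`π_φ(A)''`, that is, a positive operator `S` in `π_φ(A)''` with `⟪ξ, S ξ⟫ = 0` is zero. -/
def IsGNSFaithful (φ : A →ₚ[ℂ] ℂ) : Prop :=
  ∀ S ∈ gnsBicommutant φ, S.IsPositive → ⟪gnsVector φ, S (gnsVector φ)⟫_ℂ = 0 → S = 0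

/-- `φ` is CP-approximable: there is a net of finite-rank, unital, completely positive,
`φ`-preserving maps on `A` that converges to the identity pointwise (in norm). -/
def IsCPApproximable (φ : A →ₚ[ℂ] ℂ) : Prop :=
  ∃ (ι : Type u) (_ : Preorder ι) (_ : IsDirectedOrder ι) (_ : Nonempty ι) (T : ι → (A →CP A)),
    (∀ i, FiniteDimensional ℂ (LinearMap.range (T i).toLinearMap)) ∧
    (∀ i, T i 1 = 1) ∧
    (∀ i a, φ (T i a) = φ a) ∧
    ∀ a, Filter.Tendsto (fun i => T i a) Filter.atTop (𝓝 a)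

end StatesOnCStarAlgebras

/-- The C⋆-algebra `M_n ⊗ C(X)`, realised as the `n × n` matrices over `C(X, ℂ)`. -/
abbrev MatrixFunctionAlgebra (n : ℕ) (X : Type u) [TopologicalSpace X] : Type u :=
  CStarMatrix (Fin n) (Fin n) C(X, ℂ)

/-! ### Positive semidefinite complex matrices as Gram matrices -/

section PositiveMatrices

variable {ι : Type*} [Fintype ι]

/-! The state is an integral. The trace functional of `φ` on `C(X)` is a regular probability measure
μ, and each functional g ↦ φ(e_ij g) is bounded for the L²(μ) norm, so φ(a) = ∫ ∑ a_ij r_ij dμ with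
r measurable, positive semidefinite and of trace one (`IsState.exists_density`). GNS-faithfulness
makes r invertible almost everywhere (`IsDensity.ae_det_ne_zero`): bounded measurable matrix
functions act on the GNS space through π_φ(A)'', and the one built from the kernel projection of r
annihilates ξ, so it must vanish.

It is enough to preserve `φ` approximately from one side. Let P be a finite-rank positive unital map
of `C(X)`, applied entrywise to matrices, close to the identity on given functions and with (1 - ε)
φ∘P ≤ φ. Then ψ = φ - (1 - ε) φ∘P is a positive functional, and T = (1 - ε) P + ψ(·) 1 is unital,
completely positive, of finite rank and exactly `φ`-preserving
(`isCPApproximable_of_exists_sumSMulRight`).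

To build P, put P g = ∑ ν_k(g) f_k, where the f_k form a partition of unity and ν_k is the
normalized integral against a weight ρ_k of the same mass as f_k. Then φ∘P has density ∑ ρ_k v_k,
with v_k the f_k-average of r. For ρ_k = f_k this is close to r only in L¹, whereas domination
requires an error small relative to the least eigenvalue of r(x), which is at least det r(x) because
all eigenvalues lie in [0,1]. So f_k is cut off where the error is too large compared with det r,
and the lost mass is moved to a part of the same neighbourhood on which det r ≥ γ. There is no
circularity: the neighbourhoods, hence γ, are fixed before the partition is refined, and the lost
mass is made small against γ² (`exists_partition_of_unity_and_weights`). -/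

theorem Matrix.posSemidef_of_sum_nonneg {M : Matrix ι ι ℂ}
    (h : ∀ v : ι → ℂ, 0 ≤ ∑ i, ∑ j, star (v i) * M i j * v j) : M.PosSemidef := by
  classical
  -- No Hermitian hypothesis is needed: over ℂ, a quadratic form with real values already forces it.
  rw [← Matrix.isPositive_toEuclideanLin_iff, LinearMap.isPositive_iff_complex]
  intro x
  have hx := h x
  have hin : ⟪Matrix.toEuclideanLin M x, x⟫_ℂ = ∑ i, ∑ j, star (star (x i) * M i j * x j) := by
    simp [PiLp.inner_apply, Matrix.toLpLin_apply, Matrix.mulVec, dotProduct, Finset.mul_sum,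
      mul_comm, mul_left_comm]
  have hs : ⟪Matrix.toEuclideanLin M x, x⟫_ℂ = star (∑ i, ∑ j, star (x i) * M i j * x j) := by
    rw [hin, star_sum]; simp only [star_sum]
  have h2 : 0 ≤ ⟪Matrix.toEuclideanLin M x, x⟫_ℂ := by
    rw [hs]; exact star_nonneg_iff.mpr hx
  rw [Complex.nonneg_iff] at h2
  refine ⟨?_, h2.1⟩
  exact Complex.ext (by simp) (by simpa using h2.2)

theorem Matrix.PosSemidef.sum_nonneg {M : Matrix ι ι ℂ} (h : M.PosSemidef) (v : ι → ℂ) :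
    0 ≤ ∑ i, ∑ j, star (v i) * M i j * v j := by
  have := h.dotProduct_mulVec_nonneg v
  simpa [dotProduct, Matrix.mulVec, Finset.mul_sum, mul_assoc] using this

open scoped MatrixOrder in
theorem Matrix.PosSemidef.exists_gram {M : Matrix ι ι ℂ} (h : M.PosSemidef) :
    ∃ B : Matrix ι ι ℂ, ∀ i j, M i j = ∑ c, star (B c i) * B c j := by
  classical
  obtain ⟨B, rfl⟩ := CStarAlgebra.nonneg_iff_eq_star_mul_self.mp h.nonneg
  exact ⟨B, fun i j => by simp [Matrix.mul_apply]⟩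

end PositiveMatrices

/-! ### Complete positivity of rank-one building blocks -/

section CompletelyPositive

variable {A : Type*} [CStarAlgebra A] [PartialOrder A] [StarOrderedRing A]

theorem CStarAlgebra.exists_eq_star_mul_self {a : A} (ha : 0 ≤ a) : ∃ b, a = star b * b :=
  CStarAlgebra.nonneg_iff_eq_star_mul_self.mp ha

theorem CStarMatrix.exists_gram_of_nonneg {κ : Type*} [Fintype κ]
    {M : CStarMatrix κ κ A} (hM : 0 ≤ M) :
    ∃ N : CStarMatrix κ κ A, ∀ i j, M i j = ∑ p, star (N p i) * N p j := by
  classical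
  obtain ⟨N, rfl⟩ := CStarAlgebra.exists_eq_star_mul_self hM
  exact ⟨N, fun i j => by simp [CStarMatrix.mul_apply, CStarMatrix.star_apply]⟩

/-- Sesquilinear expansion. It turns positivity of `ψ` on sums of squares into positive
semidefiniteness of the matrix that `ψ` produces from a Gram matrix. -/
theorem LinearMap.sum_gram_apply {B ι κ : Type*} [Fintype ι] [Fintype κ] [Ring B] [StarRing B]
    [Algebra ℂ B] [StarModule ℂ B] (ψ : B →ₗ[ℂ] ℂ) (w : κ → ι → B) (v : ι → ℂ) :
    ∑ i, ∑ j, star (v i) * ψ (∑ p, star (w p i) * w p j) * v j =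
      ψ (∑ p, star (∑ i, v i • w p i) * ∑ i, v i • w p i) := by
  simp only [star_sum, Finset.sum_mul_sum, star_smul, smul_mul_smul_comm, map_sum, map_smul,
    smul_eq_mul]
  rw [eq_comm, Finset.sum_comm]
  refine Finset.sum_congr rfl fun i _ => ?_
  rw [Finset.sum_comm]
  refine Finset.sum_congr rfl fun j _ => ?_
  rw [Finset.mul_sum, Finset.sum_mul]
  exact Finset.sum_congr rfl fun p _ => by ring

/-- A positive functional, viewed as a map into scalar multiples of the unit, is completely
positive. -/
theorem PositiveLinearMap.map_smul_one_nonneg (ψ : A →ₚ[ℂ] ℂ) {k : ℕ}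
    {M : CStarMatrix (Fin k) (Fin k) A} (hM : 0 ≤ M) :
    0 ≤ M.map fun a => ψ a • (1 : A) := by
  obtain ⟨N, hN⟩ := CStarMatrix.exists_gram_of_nonneg hM
  have hG : (Matrix.of fun i j => ψ (M i j)).PosSemidef := by
    refine Matrix.posSemidef_of_sum_nonneg fun v => ?_
    have : ∑ i, ∑ j, star (v i) * Matrix.of (fun i j => ψ (M i j)) i j * v j =
        ψ (∑ p, star (∑ i, v i • N p i) * ∑ i, v i • N p i) := by
      simp only [Matrix.of_apply, hN]
      exact LinearMap.sum_gram_apply (ψ : A →ₗ[ℂ] ℂ) (fun p i => N p i) v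
    rw [this]
    exact map_nonneg ψ (Finset.sum_nonneg fun p _ => star_mul_self_nonneg _)
  obtain ⟨B, hB⟩ := hG.exists_gram
  let R : CStarMatrix (Fin k) (Fin k) A := CStarMatrix.ofMatrix fun i j => B i j • (1 : A)
  have hR : ∀ i j, R i j = B i j • (1 : A) := fun _ _ => rfl
  have : (M.map fun a => ψ a • (1 : A)) = star R * R := by
    ext i j
    simp only [Matrix.of_apply] at hB
    simp only [CStarMatrix.map_apply, CStarMatrix.mul_apply, CStarMatrix.star_apply, hR, hB,
      Finset.sum_smul, star_smul, smul_mul_smul_comm, star_one, one_mul]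
  rw [this]
  exact star_mul_self_nonneg _

variable {X : Type u} [TopologicalSpace X] [CompactSpace X] {n : ℕ}

/-- The map `a ↦ h • ν a` with `ν` a positive functional on `C(X)`, applied to all matrix entries,
is completely positive. -/
theorem CStarMatrix.map_smulRight_nonneg (ν : C(X, ℂ) →ₗ[ℂ] ℂ) (hν : ∀ g, 0 ≤ g → 0 ≤ ν g)
    (h : C(X, ℂ)) (hh : 0 ≤ h) {k : ℕ}
    {M : CStarMatrix (Fin k) (Fin k) (MatrixFunctionAlgebra n X)} (hM : 0 ≤ M) :
    0 ≤ M.map fun a => (a.map (ν.smulRight h) : MatrixFunctionAlgebra n X) := by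
  obtain ⟨N, hN⟩ := CStarMatrix.exists_gram_of_nonneg hM
  obtain ⟨s, rfl⟩ := CStarAlgebra.nonneg_iff_eq_star_mul_self.mp hh
  have hN' : ∀ i j a b, M i j a b = ∑ p, ∑ c, star (N p i c a) * N p j c b := by
    intro i j a b
    rw [hN]
    have : ∀ (t : Finset (Fin k)) (f : Fin k → MatrixFunctionAlgebra n X),
        (∑ p ∈ t, f p) a b = ∑ p ∈ t, f p a b := fun t f =>
      map_sum (⟨⟨fun x : MatrixFunctionAlgebra n X => x a b, rfl⟩, fun _ _ => rfl⟩ :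
        MatrixFunctionAlgebra n X →+ C(X, ℂ)) f t
    rw [this]
    simp [CStarMatrix.mul_apply, CStarMatrix.star_apply]
  -- The two levels of matrices are merged into one scalar matrix indexed by pairs, so that a single
  -- Gram factorization `B` serves both.
  have hG : (Matrix.of fun (i j : Fin k × Fin n) => ν (M i.1 j.1 i.2 j.2)).PosSemidef := by
    refine Matrix.posSemidef_of_sum_nonneg fun v => ?_
    have : ∑ i, ∑ j, star (v i) * Matrix.of (fun (i j : Fin k × Fin n) =>
          ν (M i.1 j.1 i.2 j.2)) i j * v j =
        ν (∑ p : Fin k × Fin n, star (∑ i : Fin k × Fin n, v i • N p.1 i.1 p.2 i.2) *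
          ∑ i : Fin k × Fin n, v i • N p.1 i.1 p.2 i.2) := by
      have hN'' : ∀ i j : Fin k × Fin n, M i.1 j.1 i.2 j.2 =
          ∑ p : Fin k × Fin n, star (N p.1 i.1 p.2 i.2) * N p.1 j.1 p.2 j.2 := fun i j => by
        rw [hN', Fintype.sum_prod_type]
      simp only [Matrix.of_apply, hN'']
      exact LinearMap.sum_gram_apply ν (fun (p i : Fin k × Fin n) => N p.1 i.1 p.2 i.2) v
    rw [this]
    exact hν _ (Finset.sum_nonneg fun p _ => star_mul_self_nonneg _)
  obtain ⟨B, hB⟩ := hG.exists_gram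
  -- The image is the tensor product of `star B * B` with `star s * s`, hence the square of `B`
  -- tensored with `s`.
  let R : CStarMatrix (Fin k) (Fin k) (MatrixFunctionAlgebra n X) :=
    CStarMatrix.ofMatrix fun p j => CStarMatrix.ofMatrix fun c b => B (p, c) (j, b) • s
  have hR : ∀ p j c b, R p j c b = B (p, c) (j, b) • s := fun _ _ _ _ => rfl
  have : (M.map fun a => (a.map (ν.smulRight (star s * s)) : MatrixFunctionAlgebra n X)) =
      star R * R := by
    refine CStarMatrix.ext fun i j => CStarMatrix.ext fun a b => ?_
    have hs : ∀ (t : Finset (Fin k)) (f : Fin k → MatrixFunctionAlgebra n X),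
        (∑ p ∈ t, f p) a b = ∑ p ∈ t, f p a b := fun t f =>
      map_sum (⟨⟨fun x : MatrixFunctionAlgebra n X => x a b, rfl⟩, fun _ _ => rfl⟩ :
        MatrixFunctionAlgebra n X →+ C(X, ℂ)) f t
    have hB' := hB (i, a) (j, b)
    simp only [Matrix.of_apply] at hB'
    rw [CStarMatrix.mul_apply, hs]
    simp only [CStarMatrix.map_apply, LinearMap.smulRight_apply, hB', CStarMatrix.mul_apply,
      CStarMatrix.star_apply, hR, Fintype.sum_prod_type,
      Finset.sum_smul, star_smul, smul_mul_smul_comm]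
  rw [this]
  exact star_mul_self_nonneg _

end CompletelyPositive

/-! ### Correcting approximate domination to exact invariance -/

section Assembly

variable {X : Type u} [TopologicalSpace X] {n : ℕ}

/-- The map `a ↦ ∑ k, ν k a • f k` on `C(X)`. -/
noncomputable def sumSMulRight {N : ℕ} (f : Fin N → C(X, ℂ)) (ν : Fin N → C(X, ℂ) →ₗ[ℂ] ℂ) :
    C(X, ℂ) →ₗ[ℂ] C(X, ℂ) :=
  ∑ k, (ν k).smulRight (f k)

theorem sumSMulRight_apply {N : ℕ} (f : Fin N → C(X, ℂ)) (ν : Fin N → C(X, ℂ) →ₗ[ℂ] ℂ)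
    (g : C(X, ℂ)) : sumSMulRight f ν g = ∑ k, ν k g • f k := by
  simp [sumSMulRight]

variable [CompactSpace X]

theorem CStarMatrix.map_sumSMulRight_nonneg {N : ℕ} {f : Fin N → C(X, ℂ)}
    {ν : Fin N → C(X, ℂ) →ₗ[ℂ] ℂ} (hf : ∀ k, 0 ≤ f k) (hν : ∀ k g, 0 ≤ g → 0 ≤ ν k g) {k : ℕ}
    {M : CStarMatrix (Fin k) (Fin k) (MatrixFunctionAlgebra n X)} (hM : 0 ≤ M) :
    0 ≤ M.map fun a => (a.map (sumSMulRight f ν) : MatrixFunctionAlgebra n X) := by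
  have : (M.map fun a => (a.map (sumSMulRight f ν) : MatrixFunctionAlgebra n X)) =
      ∑ l, M.map fun a => (a.map ((ν l).smulRight (f l)) : MatrixFunctionAlgebra n X) := by
    refine CStarMatrix.ext fun i j => CStarMatrix.ext fun a b => ?_
    have hs : ∀ (t : Finset (Fin N))
        (F : Fin N → CStarMatrix (Fin k) (Fin k) (MatrixFunctionAlgebra n X)),
        (∑ p ∈ t, F p) i j a b = ∑ p ∈ t, F p i j a b := fun t F =>
      map_sum (⟨⟨fun x : CStarMatrix (Fin k) (Fin k) (MatrixFunctionAlgebra n X) => x i j a b,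
        rfl⟩, fun _ _ => rfl⟩ :
        CStarMatrix (Fin k) (Fin k) (MatrixFunctionAlgebra n X) →+ C(X, ℂ)) F t
    rw [hs]
    simp only [CStarMatrix.map_apply, sumSMulRight_apply, LinearMap.smulRight_apply]
  rw [this]
  exact Finset.sum_nonneg fun l _ => CStarMatrix.map_smulRight_nonneg (ν l) (hν l) (f l) (hf l) hM

/-- A sufficient condition for a state to be CP-approximable: it is enough to approximate the
identity of `C(X)` by finite-rank positive maps whose amplifications nearly decrease the state. -/
theorem isCPApproximable_of_exists_sumSMulRight {φ : MatrixFunctionAlgebra n X →ₚ[ℂ] ℂ}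
    (hφ : IsState φ)
    (H : ∀ (F : Finset C(X, ℂ)) (ε : ℝ), 0 < ε → ε < 1 →
      ∃ (N : ℕ) (f : Fin N → C(X, ℂ)) (ν : Fin N → C(X, ℂ) →ₗ[ℂ] ℂ),
        (∀ k, 0 ≤ f k) ∧ (∀ k g, 0 ≤ g → 0 ≤ ν k g) ∧ sumSMulRight f ν 1 = 1 ∧
        (∀ g ∈ F, ‖sumSMulRight f ν g - g‖ ≤ ε) ∧
        ∀ a : MatrixFunctionAlgebra n X, 0 ≤ a →
          ((1 - ε : ℝ) : ℂ) * φ (a.map (sumSMulRight f ν)) ≤ φ a) :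
    IsCPApproximable φ := by
  classical
  -- The shift by 2 keeps the tolerance strictly below 1 even at m = 0, as `H` requires.
  have hε0 : ∀ m : ℕ, (0 : ℝ) < 1 / ((m : ℝ) + 2) := fun m => by positivity
  have hε1 : ∀ m : ℕ, 1 / ((m : ℝ) + 2) < 1 := fun m => by
    rw [div_lt_one (by positivity)]
    have : (0 : ℝ) ≤ m := by positivity
    linarith
  let E : Finset (MatrixFunctionAlgebra n X) → Finset C(X, ℂ) := fun S =>
    S.biUnion fun a => Finset.univ.image fun p : Fin n × Fin n => a p.1 p.2
  choose N f ν hf hν hone happ hle using fun i : Finset (MatrixFunctionAlgebra n X) × ℕ =>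
    H (E i.1) (1 / ((i.2 : ℝ) + 2)) (hε0 i.2) (hε1 i.2)
  let ε : Finset (MatrixFunctionAlgebra n X) × ℕ → ℝ := fun i => 1 / ((i.2 : ℝ) + 2)
  let Q : Finset (MatrixFunctionAlgebra n X) × ℕ →
      (MatrixFunctionAlgebra n X →ₗ[ℂ] MatrixFunctionAlgebra n X) := fun i =>
    CStarMatrix.mapₗ (sumSMulRight (f i) (ν i))
  let ψ₀ : Finset (MatrixFunctionAlgebra n X) × ℕ → (MatrixFunctionAlgebra n X →ₗ[ℂ] ℂ) :=
    fun i => (φ : MatrixFunctionAlgebra n X →ₗ[ℂ] ℂ) -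
      ((1 - ε i : ℝ) : ℂ) • (φ : MatrixFunctionAlgebra n X →ₗ[ℂ] ℂ) ∘ₗ Q i
  have hψ₀ : ∀ i a, ψ₀ i a = φ a - ((1 - ε i : ℝ) : ℂ) * φ (Q i a) := fun i a => rfl
  let ψ : Finset (MatrixFunctionAlgebra n X) × ℕ → (MatrixFunctionAlgebra n X →ₚ[ℂ] ℂ) :=
    fun i => PositiveLinearMap.mk₀ (ψ₀ i) fun a ha => by
      rw [hψ₀, sub_nonneg]
      exact hle i a ha
  -- `ψ₀` is precisely what (1 - ε) φ∘Q lacks compared with `φ`, so adding it along the unit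
  -- restores `φ`. Since `Q` and `φ` are unital, `ψ₀` takes the value ε at 1, which makes `T₀`
  -- unital.
  let T₀ : Finset (MatrixFunctionAlgebra n X) × ℕ →
      (MatrixFunctionAlgebra n X →ₗ[ℂ] MatrixFunctionAlgebra n X) := fun i =>
    ((1 - ε i : ℝ) : ℂ) • Q i + (ψ₀ i).smulRight 1
  have hT₀ : ∀ i a, T₀ i a = ((1 - ε i : ℝ) : ℂ) • Q i a + ψ₀ i a • 1 := fun i a => rfl
  have hφ1 : φ 1 = 1 := hφ
  have hQ1 : ∀ i, Q i 1 = 1 := by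
    intro i
    refine CStarMatrix.ext fun a b => ?_
    change sumSMulRight (f i) (ν i) ((1 : MatrixFunctionAlgebra n X) a b) = _
    by_cases hab : a = b
    · subst hab; rw [CStarMatrix.one_apply_eq, hone]
    · rw [CStarMatrix.one_apply_ne hab, map_zero]
  have hcp : ∀ i (k : ℕ) (M : CStarMatrix (Fin k) (Fin k) (MatrixFunctionAlgebra n X)),
      0 ≤ M → 0 ≤ M.map (T₀ i) := by
    intro i k M hM
    have hsplit : M.map (T₀ i) = ((1 - ε i : ℝ) : ℂ) • (M.map fun a =>
        (a.map (sumSMulRight (f i) (ν i)) : MatrixFunctionAlgebra n X)) +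
        M.map fun a => ψ i a • (1 : MatrixFunctionAlgebra n X) := rfl
    rw [hsplit]
    refine add_nonneg (smul_nonneg ?_ (CStarMatrix.map_sumSMulRight_nonneg (hf i) (hν i) hM))
      (PositiveLinearMap.map_smul_one_nonneg (ψ i) hM)
    exact Complex.zero_le_real.mpr (sub_nonneg.mpr (hε1 i.2).le)
  refine ⟨Finset (MatrixFunctionAlgebra n X) × ℕ, inferInstance, inferInstance, inferInstance,
    fun i => ⟨T₀ i, hcp i⟩, ?_, ?_, ?_, ?_⟩
  · intro i
    let V : Submodule ℂ (MatrixFunctionAlgebra n X) := LinearMap.range (Q i) ⊔ Submodule.span ℂ {1}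
    have hfr : FiniteDimensional ℂ (LinearMap.range (sumSMulRight (f i) (ν i))) := by
      have := FiniteDimensional.span_of_finite ℂ (Set.finite_range (f i))
      refine Submodule.finiteDimensional_of_le (S₂ := Submodule.span ℂ (Set.range (f i))) ?_
      rintro _ ⟨g, rfl⟩
      rw [sumSMulRight_apply]
      exact Submodule.sum_mem _ fun k _ =>
        Submodule.smul_mem _ _ (Submodule.subset_span ⟨k, rfl⟩)
    have hQr : FiniteDimensional ℂ (LinearMap.range (Q i)) := by
      let J : (Fin n → Fin n → LinearMap.range (sumSMulRight (f i) (ν i))) →ₗ[ℂ]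
          MatrixFunctionAlgebra n X :=
        { toFun := fun x => CStarMatrix.ofMatrix fun a b => (x a b : C(X, ℂ))
          map_add' := fun _ _ => rfl
          map_smul' := fun _ _ => rfl }
      refine Submodule.finiteDimensional_of_le (S₂ := LinearMap.range J) ?_
      rintro _ ⟨a, rfl⟩
      exact ⟨fun p q => ⟨sumSMulRight (f i) (ν i) (a p q), ⟨_, rfl⟩⟩, rfl⟩
    refine Submodule.finiteDimensional_of_le (S₂ := V) ?_
    rintro _ ⟨a, rfl⟩
    change T₀ i a ∈ V
    rw [hT₀]
    exact V.add_mem (V.smul_mem _ (Submodule.mem_sup_left ⟨a, rfl⟩))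
      (V.smul_mem _ (Submodule.mem_sup_right (Submodule.mem_span_singleton_self _)))
  · intro i
    change T₀ i 1 = 1
    rw [hT₀, hψ₀, hQ1, hφ1, ← add_smul]
    simp
  · intro i a
    change φ (T₀ i a) = φ a
    rw [hT₀, map_add, map_smul, map_smul, hφ1, hψ₀]
    simp
  · intro a
    change Filter.Tendsto (fun i => T₀ i a) Filter.atTop (𝓝 a)
    have hε : Filter.Tendsto ε Filter.atTop (𝓝 0) := by
      have h1 : Filter.Tendsto (fun m : ℕ => 1 / ((m : ℝ) + 2)) Filter.atTop (𝓝 0) :=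
        tendsto_const_nhds.div_atTop
          (Filter.tendsto_atTop_add_const_right _ _ tendsto_natCast_atTop_atTop)
      rw [← Filter.prod_atTop_atTop_eq]
      exact h1.comp Filter.tendsto_snd
    have hmem : ∀ᶠ i : Finset (MatrixFunctionAlgebra n X) × ℕ in Filter.atTop, a ∈ i.1 := by
      filter_upwards [Filter.eventually_ge_atTop ({a}, 0)] with i hi
      exact hi.1 (Finset.mem_singleton_self a)
    have hQ : Filter.Tendsto (fun i => Q i a) Filter.atTop (𝓝 a) := by
      refine tendsto_pi_nhds.mpr fun p => tendsto_pi_nhds.mpr fun q => ?_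
      rw [tendsto_iff_norm_sub_tendsto_zero]
      refine squeeze_zero' (Filter.Eventually.of_forall fun _ => norm_nonneg _) ?_ hε
      filter_upwards [hmem] with i hi
      refine happ i (a p q) ?_
      exact Finset.mem_biUnion.mpr ⟨a, hi, Finset.mem_image.mpr ⟨(p, q), Finset.mem_univ _, rfl⟩⟩
    have hc : Filter.Tendsto (fun i => ((1 - ε i : ℝ) : ℂ)) Filter.atTop (𝓝 1) := by
      have : Filter.Tendsto (fun i => 1 - ε i) Filter.atTop (𝓝 (1 - 0)) :=
        tendsto_const_nhds.sub hε
      have h2 := (Complex.continuous_ofReal.tendsto _).comp this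
      rwa [sub_zero, Complex.ofReal_one] at h2
    have hφc : Filter.Tendsto (fun i => φ (Q i a)) Filter.atTop (𝓝 (φ a)) :=
      ((map_continuous φ).tendsto a).comp hQ
    have hψt : Filter.Tendsto (fun i => ψ₀ i a) Filter.atTop (𝓝 0) := by
      simp only [hψ₀]
      have h := (tendsto_const_nhds (x := φ a)).sub (hc.mul hφc)
      rwa [one_mul, sub_self] at h
    simp only [hT₀]
    simpa using (hc.smul hQ).add (hψt.smul_const (1 : MatrixFunctionAlgebra n X))

end Assembly

/-! ### Continuous approximation, Riesz representation and L² functionals -/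

section MeasureTheoryPreliminaries

open MeasureTheory

variable {X : Type u} [TopologicalSpace X] [CompactSpace X] [MeasurableSpace X] [BorelSpace X]

theorem ContinuousMap.integrable_of_isFiniteMeasure (μ : Measure X) [IsFiniteMeasure μ]
    {E : Type*} [NormedAddCommGroup E] (g : C(X, E)) : Integrable g μ :=
  g.continuous.integrable_of_hasCompactSupport (HasCompactSupport.of_compactSpace _)

variable [T2Space X]

/-- A measurable function with values in the unit disc is an almost everywhere limit of continuous
functions with values in the unit disc. -/
theorem exists_seq_continuousMap_tendsto_ae (μ : Measure X) [IsFiniteMeasure μ] [μ.Regular]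
    {w : X → ℂ} (hw : Measurable w) (hw1 : ∀ x, ‖w x‖ ≤ 1) :
    ∃ g : ℕ → C(X, ℂ), (∀ k x, ‖g k x‖ ≤ 1) ∧
      ∀ᵐ x ∂μ, Filter.Tendsto (fun k => g k x) Filter.atTop (𝓝 (w x)) := by
  have hmem : MemLp w 1 μ :=
    (MemLp.of_bound hw.aestronglyMeasurable 1 (Filter.Eventually.of_forall hw1))
  have hk : ∀ k : ℕ, (((k : ENNReal) + 1)⁻¹) ≠ 0 := fun k => by simp
  choose g hg _ using fun k : ℕ => hmem.exists_boundedContinuous_eLpNorm_sub_le (by simp) (hk k)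
  have ht : Filter.Tendsto (fun k => eLpNorm ((g k : X → ℂ) - w) 1 μ) Filter.atTop (𝓝 0) := by
    have h0 : Filter.Tendsto (fun k : ℕ => ((k : ENNReal) + 1)⁻¹) Filter.atTop (𝓝 0) := by
      have := (Filter.tendsto_add_atTop_iff_nat 1).mpr ENNReal.tendsto_inv_nat_nhds_zero
      simpa using this
    refine tendsto_of_tendsto_of_tendsto_of_le_of_le tendsto_const_nhds h0
      (fun _ => zero_le) fun k => ?_
    change eLpNorm ((g k : X → ℂ) - w) 1 μ ≤ _
    rw [eLpNorm_sub_comm]; exact hg k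
  obtain ⟨ns, -, hns⟩ := (tendstoInMeasure_of_tendsto_eLpNorm one_ne_zero
    (fun k => (g k).continuous.aestronglyMeasurable) hw.aestronglyMeasurable
    ht).exists_seq_tendsto_ae
  -- The radial retraction onto the closed unit disc: it enforces the bound and, as it fixes the
  -- values of `w`, preserves the limit.
  have hc : Continuous fun z : ℂ => z / ((max 1 ‖z‖ : ℝ) : ℂ) := by
    refine continuous_id.div (by fun_prop) fun z => ?_
    exact_mod_cast (lt_of_lt_of_le one_pos (le_max_left 1 ‖z‖)).ne'
  refine ⟨fun k => ⟨fun x => g (ns k) x / ((max 1 ‖g (ns k) x‖ : ℝ) : ℂ),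
    hc.comp (g (ns k)).continuous⟩, fun k x => ?_, ?_⟩
  · have h1 : 0 < max 1 ‖g (ns k) x‖ := lt_of_lt_of_le one_pos (le_max_left _ _)
    change ‖g (ns k) x / ((max 1 ‖g (ns k) x‖ : ℝ) : ℂ)‖ ≤ 1
    rw [norm_div, Complex.norm_real, Real.norm_of_nonneg h1.le, div_le_one h1]
    exact le_max_right _ _
  · filter_upwards [hns] with x hx
    have h2 := (hc.tendsto (w x)).comp hx
    rwa [max_eq_left (hw1 x), Complex.ofReal_one, div_one] at h2

/-- An integrable function whose integral against every nonnegative continuous function is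
nonnegative is itself nonnegative almost everywhere. -/
theorem ae_nonneg_of_forall_integral_continuousMap_mul_nonneg {μ : Measure X} [IsFiniteMeasure μ]
    [μ.Regular] {h : X → ℂ} (hi : Integrable h μ)
    (H : ∀ g : C(X, ℂ), 0 ≤ g → 0 ≤ ∫ x, g x * h x ∂μ) : ∀ᵐ x ∂μ, 0 ≤ h x := by
  classical
  have key : ∀ s, MeasurableSet s → 0 ≤ ∫ x in s, h x ∂μ := by
    intro s hs
    -- The moduli of these approximants to the indicator of `s` are admissible test functions in
    -- `H`, bounded by 1 and with the same limit; dominated convergence does the rest.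
    obtain ⟨g, hg1, hg⟩ := exists_seq_continuousMap_tendsto_ae μ
      (w := s.indicator fun _ => (1 : ℂ)) (measurable_const.indicator hs) (fun x => by
        by_cases hx : x ∈ s <;> simp [hx])
    have hlim : Filter.Tendsto (fun k => ∫ x, ((‖g k x‖ : ℝ) : ℂ) * h x ∂μ) Filter.atTop
        (𝓝 (∫ x, s.indicator h x ∂μ)) := by
      refine tendsto_integral_of_dominated_convergence (fun x => ‖h x‖) (fun k => ?_) hi.norm
        (fun k => Filter.Eventually.of_forall fun x => ?_) ?_
      · exact ((Complex.continuous_ofReal.comp (g k).continuous.norm).aestronglyMeasurable).mul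
          hi.aestronglyMeasurable
      · rw [norm_mul, Complex.norm_real, norm_norm]
        exact mul_le_of_le_one_left (norm_nonneg _) (hg1 k x)
      · filter_upwards [hg] with x hx
        have h1 := ((Complex.continuous_ofReal.tendsto _).comp hx.norm).mul_const (h x)
        have h2 : s.indicator h x = ((‖s.indicator (fun _ => (1 : ℂ)) x‖ : ℝ) : ℂ) * h x := by
          by_cases hxs : x ∈ s
          · rw [Set.indicator_of_mem hxs, Set.indicator_of_mem hxs]; simp
          · rw [Set.indicator_of_notMem hxs, Set.indicator_of_notMem hxs]; simp
        rw [h2]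
        exact h1
    rw [integral_indicator hs] at hlim
    refine ge_of_tendsto' hlim fun k => ?_
    refine H ⟨fun x => ((‖g k x‖ : ℝ) : ℂ), Complex.continuous_ofReal.comp (g k).continuous.norm⟩ ?_
    intro x
    exact Complex.zero_le_real.mpr (norm_nonneg _)
  have hre : ∀ s, MeasurableSet s → (∫ x in s, (h x).re ∂μ) = (∫ x in s, h x ∂μ).re := fun s _ =>
    integral_re hi.integrableOn
  have him : ∀ s, MeasurableSet s → (∫ x in s, (h x).im ∂μ) = (∫ x in s, h x ∂μ).im := fun s _ =>
    integral_im hi.integrableOn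
  have h1 : 0 ≤ᵐ[μ] fun x => (h x).re :=
    ae_nonneg_of_forall_setIntegral_nonneg hi.re fun s hs _ => by
      rw [hre s hs]; exact (Complex.nonneg_iff.mp (key s hs)).1
  have h2 : (fun x => (h x).im) =ᵐ[μ] 0 :=
    Integrable.ae_eq_zero_of_forall_setIntegral_eq_zero hi.im fun s hs _ => by
      rw [him s hs]; exact (Complex.nonneg_iff.mp (key s hs)).2.symm
  filter_upwards [h1, h2] with x hx1 hx2
  exact Complex.nonneg_iff.mpr ⟨hx1, hx2.symm⟩

theorem ae_eq_zero_of_forall_integral_continuousMap_mul_eq_zero {μ : Measure X}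
    [IsFiniteMeasure μ] [μ.Regular] {h : X → ℂ} (hi : Integrable h μ)
    (H : ∀ g : C(X, ℂ), ∫ x, g x * h x ∂μ = 0) : ∀ᵐ x ∂μ, h x = 0 := by
  have h1 := ae_nonneg_of_forall_integral_continuousMap_mul_nonneg hi fun g _ => (H g).ge
  have h2 := ae_nonneg_of_forall_integral_continuousMap_mul_nonneg hi.neg fun g _ => by
    simp only [Pi.neg_apply, mul_neg, integral_neg, H]; simp
  filter_upwards [h1, h2] with x hx1 hx2
  exact le_antisymm (neg_nonneg.mp hx2) hx1

open scoped CompactlySupported in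
/-- The Riesz–Markov–Kakutani theorem for positive functionals on the complex-valued continuous
functions on a compact Hausdorff space. -/
theorem exists_regular_measure_integral_eq (τ : C(X, ℂ) →ₗ[ℂ] ℂ) (hτ : ∀ g, 0 ≤ g → 0 ≤ τ g) :
    ∃ μ : Measure X, μ.Regular ∧ IsFiniteMeasure μ ∧ ∀ g : C(X, ℂ), τ g = ∫ x, g x ∂μ := by
  let c : C(X, ℝ) → C(X, ℂ) := fun f => ⟨fun x => (f x : ℂ), by fun_prop⟩
  have hcadd : ∀ f g, c (f + g) = c f + c g := fun f g => by ext; simp [c]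
  have hcsmul : ∀ (a : ℝ) f, c (a • f) = (a : ℂ) • c f := fun a f => by ext; simp [c]
  have hcnn : ∀ f, 0 ≤ f → 0 ≤ c f := fun f hf x => Complex.zero_le_real.mpr (hf x)
  let Λ₀ : C_c(X, ℝ) →ₗ[ℝ] ℝ :=
    { toFun := fun f => (τ (c f)).re
      map_add' := fun f g => by
        have : c ((f + g : C_c(X, ℝ)) : C(X, ℝ)) = c f + c g := hcadd _ _
        rw [this, map_add, Complex.add_re]
      map_smul' := fun a f => by
        have : c ((a • f : C_c(X, ℝ)) : C(X, ℝ)) = (a : ℂ) • c f := hcsmul _ _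
        rw [this, map_smul]; simp }
  let Λ : C_c(X, ℝ) →ₚ[ℝ] ℝ := PositiveLinearMap.mk₀ Λ₀ fun f hf =>
    (Complex.nonneg_iff.mp (hτ _ (hcnn f hf))).1
  have hreal : ∀ f : C(X, ℝ), τ (c f) = ∫ x, (f x : ℂ) ∂(RealRMK.rieszMeasure Λ) := by
    have hre : ∀ f : C(X, ℝ), (τ (c f)).re = ∫ x, f x ∂(RealRMK.rieszMeasure Λ) := fun f =>
      (RealRMK.integral_rieszMeasure Λ ⟨f, HasCompactSupport.of_compactSpace _⟩).symm
    have him : ∀ f : C(X, ℝ), (τ (c f)).im = 0 := by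
      have hp : ∀ f : C(X, ℝ), 0 ≤ f → (τ (c f)).im = 0 := fun f hf =>
        (Complex.nonneg_iff.mp (hτ _ (hcnn f hf))).2.symm
      intro f
      -- Splitting into positive and negative parts shows that `τ` is real on real functions.
      have hf : f = f ⊔ 0 + (-1 : ℝ) • ((-f) ⊔ 0) := by
        ext x
        rcases le_total 0 (f x) with h | h <;> simp [h]
      rw [hf, hcadd, hcsmul, map_add, map_smul, Complex.add_im, hp _ le_sup_right]
      simp [hp _ (le_sup_right : (0 : C(X, ℝ)) ≤ (-f) ⊔ 0)]
    intro f
    rw [integral_complex_ofReal]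
    exact Complex.ext (by simpa using hre f) (by simpa using him f)
  refine ⟨RealRMK.rieszMeasure Λ, inferInstance, inferInstance, fun g => ?_⟩
  let gr : C(X, ℝ) := ⟨fun x => (g x).re, by fun_prop⟩
  let gi : C(X, ℝ) := ⟨fun x => (g x).im, by fun_prop⟩
  have hg : g = c gr + Complex.I • c gi := by
    ext x
    change g x = ((g x).re : ℂ) + Complex.I * ((g x).im : ℂ)
    rw [mul_comm, Complex.re_add_im]
  have hint : ∀ f : C(X, ℝ), Integrable (fun x => (f x : ℂ)) (RealRMK.rieszMeasure Λ) := fun f =>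
    (c f).integrable_of_isFiniteMeasure _
  have : ∫ x, g x ∂(RealRMK.rieszMeasure Λ) =
      ∫ x, ((gr x : ℂ) + Complex.I * (gi x : ℂ)) ∂(RealRMK.rieszMeasure Λ) := by
    congr 1; ext x
    exact congrArg (fun h : C(X, ℂ) => h x) hg
  rw [this, integral_add (hint gr) ((hint gi).const_mul _), integral_const_mul, ← hreal, ← hreal]
  conv_lhs => rw [hg]
  simp

/-- A functional on `C(X)` that is bounded for the `L²` norm is integration against a
square-integrable function. -/
theorem exists_memLp_two_integral_eq (μ : Measure X) [IsFiniteMeasure μ] [μ.Regular]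
    (L : C(X, ℂ) →ₗ[ℂ] ℂ) (hL : ∀ g, ‖L g‖ ^ 2 ≤ ∫ x, ‖g x‖ ^ 2 ∂μ) :
    ∃ r : X → ℂ, Measurable r ∧ MemLp r 2 μ ∧ ∀ g : C(X, ℂ), L g = ∫ x, g x * r x ∂μ := by
  let e : C(X, ℂ) →L[ℂ] Lp ℂ 2 μ := ContinuousMap.toLp 2 μ ℂ
  have hnorm : ∀ g, ‖L g‖ ≤ 1 * ‖e g‖ := by
    intro g
    rw [one_mul, ← sq_le_sq₀ (norm_nonneg _) (norm_nonneg _)]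
    refine (hL g).trans (le_of_eq ?_)
    have h1 : ((‖e g‖ ^ 2 : ℝ) : ℂ) = ((∫ x, ‖g x‖ ^ 2 ∂μ : ℝ) : ℂ) := by
      have := inner_self_eq_norm_sq_to_K (𝕜 := ℂ) (e g)
      rw [Complex.ofReal_pow]
      refine this.symm.trans ?_
      rw [MeasureTheory.L2.inner_def, ← integral_complex_ofReal]
      refine integral_congr_ae ?_
      filter_upwards [ContinuousMap.coeFn_toLp (p := 2) (𝕜 := ℂ) μ g] with x hx
      rw [hx, inner_self_eq_norm_sq_to_K]
      simp
    exact_mod_cast h1.symm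
  have hd : DenseRange (e : C(X, ℂ) →ₗ[ℂ] Lp ℂ 2 μ) :=
    ContinuousMap.toLp_denseRange ℂ μ ℂ (by simp)
  let ψ : Lp ℂ 2 μ →L[ℂ] ℂ := L.extendOfNorm (e : C(X, ℂ) →ₗ[ℂ] Lp ℂ 2 μ)
  let w : Lp ℂ 2 μ := (InnerProductSpace.toDual ℂ (Lp ℂ 2 μ)).symm ψ
  -- The conjugate appears because the inner product is conjugate-linear in the first variable.
  refine ⟨fun x => star (w x), ?_, ?_, fun g => ?_⟩
  · exact continuous_star.measurable.comp (Lp.stronglyMeasurable w).measurable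
  · exact (Lp.memLp w).star
  · have h1 : ψ (e g) = L g := LinearMap.extendOfNorm_eq hd ⟨1, hnorm⟩ g
    rw [← h1, ← InnerProductSpace.toDual_symm_apply (𝕜 := ℂ) (x := e g) (y := ψ),
      MeasureTheory.L2.inner_def]
    refine integral_congr_ae ?_
    filter_upwards [ContinuousMap.coeFn_toLp (p := 2) (𝕜 := ℂ) μ g] with x hx
    rw [hx]
    simp [w]

end MeasureTheoryPreliminaries

/-! ### The matrix-valued density of a state -/

section Density

open MeasureTheory

variable {A : Type*} [CStarAlgebra A] [PartialOrder A] [StarOrderedRing A] in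
-- Cauchy–Schwarz in the pre-GNS space, against the class of 1, which is a unit vector.
theorem IsState.norm_apply_sq_le {φ : A →ₚ[ℂ] ℂ} (hφ : IsState φ) (a : A) :
    ‖φ a‖ ^ 2 ≤ (φ (star a * a)).re := by
  have h1 : ⟪φ.toPreGNS 1, φ.toPreGNS a⟫_ℂ = φ a := by
    rw [PositiveLinearMap.preGNS_inner_def]; simp
  have h2 : ‖φ.toPreGNS (1 : A)‖ = 1 := by
    have hφ1 : φ 1 = 1 := hφ
    rw [PositiveLinearMap.preGNS_norm_def]; simp [hφ1]
  have h3 : ‖φ.toPreGNS a‖ ^ 2 = (φ (star a * a)).re := by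
    have := PositiveLinearMap.preGNS_norm_sq φ (φ.toPreGNS a)
    rw [PositiveLinearMap.ofPreGNS_toPreGNS] at this
    rw [← this]
    norm_cast
  have h4 := norm_inner_le_norm (𝕜 := ℂ) (φ.toPreGNS 1) (φ.toPreGNS a)
  rw [h1, h2, one_mul] at h4
  rw [← h3]
  gcongr

variable {X : Type u} [TopologicalSpace X] {n : ℕ}

/-- The matrix of functions with entry `g` at `(i, j)` and zero elsewhere. -/
noncomputable def matUnit (i j : Fin n) : C(X, ℂ) →ₗ[ℂ] MatrixFunctionAlgebra n X where
  toFun g := CStarMatrix.ofMatrix (Matrix.single i j g)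
  map_add' f g := congrArg CStarMatrix.ofMatrix (Matrix.single_add i j f g)
  map_smul' c g := congrArg CStarMatrix.ofMatrix (Matrix.smul_single c i j g).symm

theorem matUnit_apply (i j a b : Fin n) (g : C(X, ℂ)) :
    matUnit i j g a b = if i = a ∧ j = b then g else 0 :=
  Matrix.single_apply i j g a b

theorem MatrixFunctionAlgebra.sum_apply {ι : Type*} (t : Finset ι)
    (f : ι → MatrixFunctionAlgebra n X) (a b : Fin n) : (∑ p ∈ t, f p) a b = ∑ p ∈ t, f p a b :=
  map_sum (⟨⟨fun x : MatrixFunctionAlgebra n X => x a b, rfl⟩, fun _ _ => rfl⟩ :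
    MatrixFunctionAlgebra n X →+ C(X, ℂ)) f t

theorem MatrixFunctionAlgebra.eq_sum_matUnit (a : MatrixFunctionAlgebra n X) :
    a = ∑ i, ∑ j, matUnit i j (a i j) := by
  refine CStarMatrix.ext fun p q => ?_
  simp [MatrixFunctionAlgebra.sum_apply, matUnit_apply, ite_and]

theorem matUnit_mul_matUnit (i j k l : Fin n) (f g : C(X, ℂ)) :
    matUnit i j f * matUnit k l g = if j = k then matUnit i l (f * g) else 0 := by
  split_ifs with h
  · subst h; exact congrArg CStarMatrix.ofMatrix (Matrix.single_mul_single_same f i j l g)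
  · exact congrArg CStarMatrix.ofMatrix (Matrix.single_mul_single_of_ne f i j k h g)

theorem star_matUnit (i j : Fin n) (f : C(X, ℂ)) :
    star (matUnit i j f) = matUnit j i (star f) :=
  congrArg CStarMatrix.ofMatrix (Matrix.conjTranspose_single i j f)

variable [CompactSpace X]

/-- A tensor product of squares is a square. These elements are the test elements that detect
positivity of the density. -/
theorem MatrixFunctionAlgebra.nonneg_of_posSemidef {G : Matrix (Fin n) (Fin n) ℂ}
    (hG : G.PosSemidef) {f : C(X, ℂ)} (hf : 0 ≤ f) :
    0 ≤ (CStarMatrix.ofMatrix fun i j => G i j • f : MatrixFunctionAlgebra n X) := by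
  obtain ⟨s, rfl⟩ := CStarAlgebra.exists_eq_star_mul_self hf
  obtain ⟨B, hB⟩ := hG.exists_gram
  let R : MatrixFunctionAlgebra n X := CStarMatrix.ofMatrix fun i j => B i j • s
  have hR : ∀ i j, R i j = B i j • s := fun _ _ => rfl
  have : (CStarMatrix.ofMatrix fun i j => G i j • (star s * s) : MatrixFunctionAlgebra n X) =
      star R * R := by
    refine CStarMatrix.ext fun i j => ?_
    change G i j • (star s * s) = _
    simp only [CStarMatrix.mul_apply, CStarMatrix.star_apply, hR, hB,
      Finset.sum_smul, star_smul, smul_mul_smul_comm]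
  rw [this]
  exact star_mul_self_nonneg _

theorem MatrixFunctionAlgebra.matUnit_self_nonneg (i : Fin n) {f : C(X, ℂ)} (hf : 0 ≤ f) :
    0 ≤ (matUnit i i f : MatrixFunctionAlgebra n X) := by
  obtain ⟨s, rfl⟩ := CStarAlgebra.exists_eq_star_mul_self hf
  have : (matUnit i i (star s * s) : MatrixFunctionAlgebra n X) =
      star (matUnit i i s) * matUnit i i s := by
    rw [star_matUnit, matUnit_mul_matUnit, if_pos rfl]
  rw [this]
  exact star_mul_self_nonneg _

variable [T2Space X] [MeasurableSpace X] [BorelSpace X]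

/-- A state on `M_n ⊗ C(X)` has a square-integrable matrix-valued density with respect to a regular
Borel probability measure on `X`, positive semidefinite and of trace one almost everywhere. -/
theorem IsState.exists_memLp_density {φ : MatrixFunctionAlgebra n X →ₚ[ℂ] ℂ} (hφ : IsState φ) :
    ∃ μ : Measure X, μ.Regular ∧ IsProbabilityMeasure μ ∧
      ∃ r : Fin n → Fin n → X → ℂ, (∀ i j, Measurable (r i j)) ∧ (∀ i j, Integrable (r i j) μ) ∧
        (∀ i j g, φ (matUnit i j g) = ∫ x, g x * r i j x ∂μ) ∧
        (∀ᵐ x ∂μ, (Matrix.of fun i j => r i j x).PosSemidef) ∧ ∀ᵐ x ∂μ, ∑ i, r i i x = 1 := by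
  let L : Fin n → Fin n → C(X, ℂ) →ₗ[ℂ] ℂ := fun i j =>
    (φ : MatrixFunctionAlgebra n X →ₗ[ℂ] ℂ) ∘ₗ matUnit i j
  have hL : ∀ i j g, L i j g = φ (matUnit i j g) := fun _ _ _ => rfl
  let τ : C(X, ℂ) →ₗ[ℂ] ℂ := ∑ i, L i i
  have hτ : ∀ g, τ g = ∑ i, L i i g := fun g => by simp [τ]
  have hLnn : ∀ i g, 0 ≤ g → 0 ≤ L i i g := fun i g hg =>
    map_nonneg φ (MatrixFunctionAlgebra.matUnit_self_nonneg i hg)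
  obtain ⟨μ, hreg, hfin, hμ⟩ := exists_regular_measure_integral_eq τ fun g hg => by
    rw [hτ]; exact Finset.sum_nonneg fun i _ => hLnn i g hg
  have hτ1 : τ 1 = 1 := by
    have hφ1 : φ 1 = 1 := hφ
    rw [hτ, ← hφ1, MatrixFunctionAlgebra.eq_sum_matUnit (1 : MatrixFunctionAlgebra n X), map_sum]
    refine Finset.sum_congr rfl fun i _ => ?_
    rw [map_sum, Finset.sum_eq_single i]
    · rw [CStarMatrix.one_apply_eq, hL]
    · intro j _ hj
      rw [CStarMatrix.one_apply_ne hj.symm, map_zero, map_zero]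
    · simp
  have hprob : IsProbabilityMeasure μ := by
    have h1 := hμ 1
    rw [hτ1] at h1
    simp only [ContinuousMap.one_apply, integral_const] at h1
    constructor
    have h2 : μ.real Set.univ = 1 := by
      have : (μ.real Set.univ • (1 : ℂ)) = 1 := h1.symm
      simpa using this
    rw [Measure.real, ENNReal.toReal_eq_one_iff] at h2
    exact h2
  -- By Cauchy–Schwarz, |φ(e_ij g)|² ≤ φ(e_jj |g|²), and this is at most the full trace functional
  -- at |g|².
  have hbound : ∀ i j g, ‖L i j g‖ ^ 2 ≤ ∫ x, ‖g x‖ ^ 2 ∂μ := by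
    intro i j g
    refine (hφ.norm_apply_sq_le _).trans ?_
    rw [star_matUnit, matUnit_mul_matUnit, if_pos rfl, ← hL]
    have h1 : L j j (star g * g) ≤ τ (star g * g) := by
      rw [hτ]
      exact Finset.single_le_sum (f := fun i => L i i (star g * g))
        (fun i _ => hLnn i _ (star_mul_self_nonneg g)) (Finset.mem_univ j)
    have h2 : τ (star g * g) = ((∫ x, ‖g x‖ ^ 2 ∂μ : ℝ) : ℂ) := by
      rw [hμ, ← integral_complex_ofReal]
      congr 1; ext x
      simp [Complex.conj_mul']
    rw [h2] at h1
    exact (Complex.le_def.mp h1).1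
  choose r hrm hr2 hr using fun i j => exists_memLp_two_integral_eq μ (L i j) (hbound i j)
  have hint : ∀ i j, Integrable (r i j) μ := fun i j => (hr2 i j).integrable (by norm_num)
  have hgint : ∀ i j (g : C(X, ℂ)), Integrable (fun x => g x * r i j x) μ := fun i j g =>
    (hint i j).bdd_mul g.continuous.aestronglyMeasurable
      (Filter.Eventually.of_forall fun x => g.norm_coe_le_norm x)
  refine ⟨μ, hreg, hprob, r, hrm, hint, fun i j g => by rw [← hL, hr], ?_, ?_⟩
  · have hv : ∀ v : Fin n → ℂ, ∀ᵐ x ∂μ, 0 ≤ ∑ i, ∑ j, star (v i) * r i j x * v j := by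
      intro v
      refine ae_nonneg_of_forall_integral_continuousMap_mul_nonneg
        (integrable_finsetSum _ fun i _ => integrable_finsetSum _ fun j _ =>
          ((hint i j).const_mul _).mul_const _) fun g hg => ?_
      have hG : (Matrix.of fun i j => star (v i) * v j).PosSemidef := by
        have := Matrix.posSemidef_vecMulVec_star_self v
        exact this
      have h1 := map_nonneg φ (MatrixFunctionAlgebra.nonneg_of_posSemidef hG hg)
      rw [MatrixFunctionAlgebra.eq_sum_matUnit (CStarMatrix.ofMatrix fun i j =>
        Matrix.of (fun i j => star (v i) * v j) i j • g : MatrixFunctionAlgebra n X)] at h1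
      have h2 : ∫ x, g x * ∑ i, ∑ j, star (v i) * r i j x * v j ∂μ =
          ∑ i, ∑ j, star (v i) * v j * L i j g := by
        have hi : ∀ i j, Integrable (fun x => g x * (star (v i) * r i j x * v j)) μ := fun i j =>
          ((hgint i j g).const_mul (star (v i) * v j)).congr
            (Filter.Eventually.of_forall fun x => by ring)
        simp only [hr, Finset.mul_sum]
        rw [integral_finsetSum _ fun i _ => integrable_finsetSum _ fun j _ => hi i j]
        refine Finset.sum_congr rfl fun i _ => ?_
        rw [integral_finsetSum _ fun j _ => hi i j]
        refine Finset.sum_congr rfl fun j _ => ?_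
        rw [← integral_const_mul]
        congr 1; ext x; ring
      rw [h2]
      convert h1 using 1
      rw [map_sum]
      refine Finset.sum_congr rfl fun i _ => ?_
      rw [map_sum]
      refine Finset.sum_congr rfl fun j _ => ?_
      change _ = L i j ((star (v i) * v j) • g)
      rw [map_smul, smul_eq_mul]
    -- The exceptional null set depends on the vector; a countable dense set of vectors and
    -- closedness of the inequality give one null set for all of them.
    have hall := ae_all_iff.mpr fun k : ℕ => hv (TopologicalSpace.denseSeq (Fin n → ℂ) k)
    filter_upwards [hall] with x hx
    refine Matrix.posSemidef_of_sum_nonneg fun v => ?_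
    have hcl : IsClosed {v : Fin n → ℂ | 0 ≤ ∑ i, ∑ j, star (v i) * r i j x * v j} :=
      isClosed_le continuous_const (by fun_prop)
    exact hcl.closure_subset_iff.mpr (Set.range_subset_iff.mpr hx)
      (TopologicalSpace.denseRange_denseSeq (Fin n → ℂ) v)
  · have hz : ∀ g : C(X, ℂ), ∫ x, g x * (∑ i, r i i x - 1) ∂μ = 0 := by
      intro g
      have h1 : (fun x => g x * (∑ i, r i i x - 1)) = fun x => ∑ i, g x * r i i x - g x := by
        ext x; rw [mul_sub, Finset.mul_sum, mul_one]
      rw [h1, integral_sub (integrable_finsetSum _ fun i _ => hgint i i g)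
        (g.integrable_of_isFiniteMeasure μ), integral_finsetSum _ fun i _ => hgint i i g, ← hμ, hτ]
      simp [hr]
    have hi : Integrable (fun x => ∑ i, r i i x - 1) μ :=
      (integrable_finsetSum _ fun i _ => hint i i).sub (integrable_const _)
    filter_upwards [ae_eq_zero_of_forall_integral_continuousMap_mul_eq_zero hi hz] with x hx
    exact sub_eq_zero.mp hx

/-- `r` is a matrix-valued density of `φ` with respect to `μ`, everywhere positive semidefinite and
of trace one. -/
structure IsDensity (φ : MatrixFunctionAlgebra n X →ₚ[ℂ] ℂ) (μ : Measure X)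
    (r : X → Matrix (Fin n) (Fin n) ℂ) : Prop where
  measurable : ∀ i j, Measurable fun x => r x i j
  posSemidef : ∀ x, (r x).PosSemidef
  trace_eq_one : ∀ x, (r x).trace = 1
  apply_eq : ∀ a, φ a = ∑ i, ∑ j, ∫ x, a i j x * r x i j ∂μ

/-- A state on `M_n ⊗ C(X)` has a matrix-valued density with respect to a regular Borel probability
measure on `X`, everywhere positive semidefinite and of trace one. -/
theorem IsState.exists_density {φ : MatrixFunctionAlgebra n X →ₚ[ℂ] ℂ} (hφ : IsState φ) :
    ∃ μ : Measure X, μ.Regular ∧ IsProbabilityMeasure μ ∧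
      ∃ r : X → Matrix (Fin n) (Fin n) ℂ, IsDensity φ μ r := by
  classical
  have hn : n ≠ 0 := by
    rintro rfl
    have h1 : φ 1 = 1 := hφ
    have h2 : (1 : MatrixFunctionAlgebra 0 X) = 0 := CStarMatrix.ext fun i => i.elim0
    rw [h2, map_zero] at h1
    exact zero_ne_one h1
  obtain ⟨μ, hreg, hprob, r, hrm, -, hr, hpsd, htr⟩ := hφ.exists_memLp_density
  obtain ⟨t, ht, htm, ht0⟩ := exists_measurable_superset_of_null (ae_iff.mp (hpsd.and htr))
  have hgood : ∀ x, x ∉ t → (Matrix.of fun i j => r i j x).PosSemidef ∧ ∑ i, r i i x = 1 :=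
    fun x hx => not_not.mp fun h => hx (ht h)
  -- On the measurable null set `t` the density is replaced by the normalized identity, which has
  -- trace one because n ≠ 0.
  refine ⟨μ, hreg, hprob, fun x => if x ∈ t then ((n : ℝ)⁻¹ : ℝ) • 1 else
    Matrix.of fun i j => r i j x, fun i j => ?_, fun x => ?_, fun x => ?_, fun a => ?_⟩
  · have : (fun x => (if x ∈ t then ((n : ℝ)⁻¹ : ℝ) • (1 : Matrix (Fin n) (Fin n) ℂ) else
        Matrix.of fun i j => r i j x) i j) = fun x => if x ∈ t then
        (((n : ℝ)⁻¹ : ℝ) • (1 : Matrix (Fin n) (Fin n) ℂ)) i j else r i j x := by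
      ext x; split_ifs <;> rfl
    rw [this]
    exact Measurable.ite htm measurable_const (hrm i j)
  · split_ifs with hx
    · exact Matrix.PosSemidef.one.smul (by positivity)
    · exact (hgood x hx).1
  · split_ifs with hx
    · rw [Matrix.trace_smul, Matrix.trace_one, Fintype.card_fin, Complex.real_smul]
      push_cast
      exact inv_mul_cancel₀ (Nat.cast_ne_zero.mpr hn)
    · exact (hgood x hx).2
  · conv_lhs => rw [MatrixFunctionAlgebra.eq_sum_matUnit a]
    rw [map_sum]
    refine Finset.sum_congr rfl fun i _ => ?_
    rw [map_sum]
    refine Finset.sum_congr rfl fun j _ => ?_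
    rw [hr]
    refine integral_congr_ae ?_
    filter_upwards [(measure_eq_zero_iff_ae_notMem.mp ht0)] with x hx
    rw [if_neg hx, Matrix.of_apply]

end Density

/-! ### Spectral estimates for density matrices -/

section DensityMatrices

open scoped Matrix

variable {ι : Type*} [Fintype ι]

theorem Matrix.PosSemidef.norm_apply_le_trace {M : Matrix ι ι ℂ} (h : M.PosSemidef) (i j : ι) :
    ‖M i j‖ ≤ M.trace.re := by
  obtain ⟨B, hB⟩ := h.exists_gram
  have hd : ∀ i, (M i i).re = ∑ c, ‖B c i‖ ^ 2 := fun i => by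
    rw [hB, Complex.re_sum]
    refine Finset.sum_congr rfl fun c _ => ?_
    rw [Complex.star_def, Complex.conj_mul', ← Complex.ofReal_pow, Complex.ofReal_re]
  have hle : ∀ i, (M i i).re ≤ M.trace.re := fun i => by
    rw [Matrix.trace, Complex.re_sum]
    exact Finset.single_le_sum (f := fun i => (M.diag i).re)
      (fun i _ => (Complex.nonneg_iff.mp h.diag_nonneg).1) (Finset.mem_univ i)
  have h1 : ‖M i j‖ ≤ ∑ c, (‖B c i‖ ^ 2 + ‖B c j‖ ^ 2) / 2 := by
    rw [hB]
    refine (norm_sum_le _ _).trans (Finset.sum_le_sum fun c _ => ?_)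
    rw [norm_mul, norm_star]
    nlinarith [sq_nonneg (‖B c i‖ - ‖B c j‖)]
  rw [← Finset.sum_div, Finset.sum_add_distrib, ← hd, ← hd] at h1
  linarith [hle i, hle j]

variable [DecidableEq ι]

/-- A density matrix can be diagonalised by a unitary, with eigenvalues in the unit interval. -/
theorem Matrix.PosSemidef.exists_diagonalization {M : Matrix ι ι ℂ} (h : M.PosSemidef)
    (htr : M.trace = 1) :
    ∃ (V : Matrix ι ι ℂ) (e : ι → ℝ), V * Vᴴ = 1 ∧ Vᴴ * V = 1 ∧
      M = V * Matrix.diagonal (fun i => (e i : ℂ)) * Vᴴ ∧ (∀ i, 0 ≤ e i) ∧ (∀ i, e i ≤ 1) ∧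
      M.det = ((∏ i, e i : ℝ) : ℂ) := by
  refine ⟨h.1.eigenvectorUnitary, h.1.eigenvalues, ?_, ?_, ?_, h.eigenvalues_nonneg, fun i => ?_,
    ?_⟩
  · exact Unitary.mul_star_self_of_mem h.1.eigenvectorUnitary.2
  · exact Unitary.star_mul_self_of_mem h.1.eigenvectorUnitary.2
  · exact h.1.spectral_theorem
  · have h1 : ∑ i, h.1.eigenvalues i = 1 := by
      have := h.1.trace_eq_sum_eigenvalues
      rw [htr] at this
      apply Complex.ofReal_injective
      rw [Complex.ofReal_sum]
      exact this.symm
    rw [← h1]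
    exact Finset.single_le_sum (fun i _ => h.eigenvalues_nonneg i) (Finset.mem_univ i)
  · rw [Complex.ofReal_prod]
    exact h.1.det_eq_prod_eigenvalues

/-- With all eigenvalues in [0,1], their product is at most each of them. The determinant thus
serves as a lower spectral bound that is visibly measurable in the matrix entries. -/
theorem Matrix.PosSemidef.sub_det_smul_one {M : Matrix ι ι ℂ} (h : M.PosSemidef)
    (htr : M.trace = 1) : (M - M.det • (1 : Matrix ι ι ℂ)).PosSemidef := by
  obtain ⟨V, e, hV, -, hM, he0, he1, hdet⟩ := h.exists_diagonalization htr
  have h1 : M - M.det • (1 : Matrix ι ι ℂ) =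
      V * Matrix.diagonal (fun i => (e i : ℂ) - M.det) * Vᴴ := by
    rw [← Matrix.diagonal_sub, ← Matrix.smul_one_eq_diagonal, mul_sub, sub_mul, ← hM, mul_smul_comm,
      mul_one, smul_mul_assoc, hV]
  rw [h1]
  refine Matrix.PosSemidef.mul_mul_conjTranspose_same ?_ _
  rw [Matrix.posSemidef_diagonal_iff]
  intro i
  rw [hdet, sub_nonneg, Complex.real_le_real, ← Finset.mul_prod_erase _ _ (Finset.mem_univ i)]
  exact mul_le_of_le_one_right (he0 i)
    (Finset.prod_le_one (fun j _ => he0 j) fun j _ => he1 j)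

/-- The pairing of a positive semidefinite matrix with a density matrix dominates the determinant
of the latter. -/
theorem Matrix.PosSemidef.det_mul_trace_le_sum_mul {a M : Matrix ι ι ℂ} (ha : a.PosSemidef)
    (h : M.PosSemidef) (htr : M.trace = 1) :
    M.det.re * a.trace.re ≤ (∑ i, ∑ j, a i j * M i j).re := by
  obtain ⟨B, hB⟩ := ha.exists_gram
  have key : 0 ≤ ∑ i, ∑ j, a i j * (M - M.det • (1 : Matrix ι ι ℂ)) i j := by
    have h1 : ∑ i, ∑ j, a i j * (M - M.det • (1 : Matrix ι ι ℂ)) i j =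
        ∑ c, ∑ i, ∑ j, star (B c i) * (M - M.det • (1 : Matrix ι ι ℂ)) i j * B c j := by
      rw [eq_comm, Finset.sum_comm]
      refine Finset.sum_congr rfl fun i _ => ?_
      rw [Finset.sum_comm]
      refine Finset.sum_congr rfl fun j _ => ?_
      rw [hB, Finset.sum_mul]
      exact Finset.sum_congr rfl fun c _ => by ring
    rw [h1]
    exact Finset.sum_nonneg fun c _ => (h.sub_det_smul_one htr).sum_nonneg (B c)
  have h2 : ∑ i, ∑ j, a i j * (M - M.det • (1 : Matrix ι ι ℂ)) i j =
      ∑ i, ∑ j, a i j * M i j - M.det * a.trace := by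
    simp [Matrix.sub_apply, Matrix.smul_apply, Matrix.one_apply, mul_sub, Finset.sum_sub_distrib,
      Matrix.trace, Finset.mul_sum, mul_comm]
  rw [h2] at key
  have h3 := (Complex.nonneg_iff.mp key).1
  have h4 : (M.det).im = 0 := (Complex.nonneg_iff.mp h.det_nonneg).2.symm
  rw [Complex.sub_re, Complex.mul_re, h4] at h3
  linarith

/-- The powers of `1 - M`, for a density matrix `M`, converge to a matrix that annihilates `M` and
vanishes only if `M` is invertible. -/
theorem Matrix.PosSemidef.exists_tendsto_one_sub_pow {M : Matrix ι ι ℂ} (h : M.PosSemidef)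
    (htr : M.trace = 1) :
    ∃ q : Matrix ι ι ℂ, Filter.Tendsto (fun m : ℕ => (1 - M) ^ m) Filter.atTop (𝓝 q) ∧
      q * M = 0 ∧ (q = 0 → M.det ≠ 0) := by
  obtain ⟨V, e, hV, hV', hM, he0, he1, -⟩ := h.exists_diagonalization htr
  -- The pointwise limit of (1 - e)^m for e in [0,1], so the limit matrix is the kernel projection
  -- of `M`.
  let d : ι → ℂ := fun i => if e i = 0 then 1 else 0
  have hpow : ∀ m : ℕ, (1 - M) ^ m = V * Matrix.diagonal (fun i => (1 - (e i : ℂ)) ^ m) * Vᴴ := by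
    intro m
    induction m with
    | zero => simp [hV]
    | succ m ih =>
      have h2 : 1 - M = V * Matrix.diagonal (fun i => 1 - (e i : ℂ)) * Vᴴ := by
        rw [← Matrix.diagonal_sub, Matrix.diagonal_one, mul_sub, sub_mul, mul_one, hV, ← hM]
      rw [pow_succ, ih, h2]
      calc V * Matrix.diagonal (fun i => (1 - (e i : ℂ)) ^ m) * Vᴴ *
            (V * Matrix.diagonal (fun i => 1 - (e i : ℂ)) * Vᴴ)
          = V * (Matrix.diagonal (fun i => (1 - (e i : ℂ)) ^ m) * (Vᴴ * V) *
            Matrix.diagonal (fun i => 1 - (e i : ℂ))) * Vᴴ := by simp only [Matrix.mul_assoc]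
        _ = _ := by rw [hV', mul_one, Matrix.diagonal_mul_diagonal]; simp only [pow_succ]
  have hlim : Filter.Tendsto (fun m : ℕ => (1 - M) ^ m) Filter.atTop
      (𝓝 (V * Matrix.diagonal d * Vᴴ)) := by
    simp only [hpow]
    have hc : Continuous fun v : ι → ℂ => V * Matrix.diagonal v * Vᴴ := by fun_prop
    refine (hc.tendsto d).comp (tendsto_pi_nhds.mpr fun i => ?_)
    by_cases hi : e i = 0
    · simp [d, hi]
    · simp only [d, if_neg hi]
      refine tendsto_pow_atTop_nhds_zero_of_norm_lt_one ?_
      have h3 : (1 - (e i : ℂ)) = ((1 - e i : ℝ) : ℂ) := by push_cast; rfl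
      rw [h3, Complex.norm_real, Real.norm_of_nonneg (by linarith [he1 i])]
      have : 0 < e i := lt_of_le_of_ne (he0 i) (Ne.symm hi)
      linarith
  refine ⟨V * Matrix.diagonal d * Vᴴ, hlim, ?_, fun hq hdet => ?_⟩
  · have h4 : Matrix.diagonal d * Matrix.diagonal (fun i => (e i : ℂ)) = 0 := by
      rw [Matrix.diagonal_mul_diagonal, ← Matrix.diagonal_zero]
      congr 1; ext i
      by_cases hi : e i = 0 <;> simp [d, hi]
    calc V * Matrix.diagonal d * Vᴴ * M
        = V * (Matrix.diagonal d * (Vᴴ * V) * Matrix.diagonal (fun i => (e i : ℂ))) * Vᴴ := by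
          conv_lhs => rw [hM]
          simp only [Matrix.mul_assoc]
      _ = 0 := by rw [hV', mul_one, h4]; simp
  -- A kernel vector of `M` is fixed by every power of 1 - M, hence by the limit, which therefore
  -- cannot be zero.
  · obtain ⟨v, hv0, hv⟩ := Matrix.exists_mulVec_eq_zero_iff.mpr hdet
    have hfix : ∀ m : ℕ, ((1 - M) ^ m).mulVec v = v := by
      intro m
      induction m with
      | zero => simp
      | succ m ih => rw [pow_succ, ← Matrix.mulVec_mulVec, Matrix.sub_mulVec, hv]; simpa using ih
    rw [hq] at hlim
    have hc : Continuous fun D : Matrix ι ι ℂ => D.mulVec v := by fun_prop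
    have := (hc.tendsto 0).comp hlim
    rw [Matrix.zero_mulVec] at this
    exact hv0 (tendsto_nhds_unique (tendsto_const_nhds.congr fun m => (hfix m).symm) this)

end DensityMatrices

/-! ### Bounded measurable functions in the GNS bicommutant -/

section Faithful

open MeasureTheory

/-- A uniformly bounded sequence of operators that is pointwise Cauchy on a dense set converges
strongly. -/
theorem exists_strong_limit_of_cauchySeq {E F ι : Type*} [NormedAddCommGroup E] [NormedSpace ℂ E]
    [CompleteSpace E] [NormedAddCommGroup F] [NormedSpace ℂ F] [CompleteSpace F] (T : ℕ → E →L[ℂ] F)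
    (hT : ∀ k x, ‖T k x‖ ≤ ‖x‖) (j : ι → E) (hj : DenseRange j)
    (hc : ∀ a, CauchySeq fun k => T k (j a)) :
    ∃ S : E →L[ℂ] F, ∀ x, Filter.Tendsto (fun k => T k x) Filter.atTop (𝓝 (S x)) := by
  have hall : ∀ x, CauchySeq fun k => T k x := by
    intro x
    rw [Metric.cauchySeq_iff']
    intro ε hε
    obtain ⟨a, ha⟩ := hj.exists_dist_lt x (show 0 < ε / 3 by positivity)
    obtain ⟨N, hN⟩ := Metric.cauchySeq_iff'.mp (hc a) (ε / 3) (by positivity)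
    refine ⟨N, fun k hk => ?_⟩
    have h1 : ∀ k, dist (T k x) (T k (j a)) < ε / 3 := fun k => by
      rw [dist_eq_norm, ← map_sub]
      exact (hT k _).trans_lt (by rwa [← dist_eq_norm])
    calc dist (T k x) (T N x)
        ≤ dist (T k x) (T k (j a)) + dist (T k (j a)) (T N (j a)) +
          dist (T N (j a)) (T N x) := dist_triangle4 _ _ _ _
      _ < ε / 3 + ε / 3 + ε / 3 := by
          have := h1 N
          rw [dist_comm] at this
          linarith [h1 k, hN k hk]
      _ = ε := by ring
  choose S hS using fun x => cauchySeq_tendsto_of_complete (hall x)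
  exact ⟨continuousLinearMapOfTendsto T (f := S) (tendsto_pi_nhds.mpr hS), hS⟩

variable {X : Type u} [TopologicalSpace X] {n : ℕ}

/-- The pointwise bilinear pairing of a matrix of functions with a matrix-valued function. -/
noncomputable def densityPairing (r : X → Matrix (Fin n) (Fin n) ℂ)
    (a : MatrixFunctionAlgebra n X) (x : X) : ℂ :=
  ∑ i, ∑ j, a i j x * r x i j

/-- The pairing has no transpose, so each row of the matrices contributes the sesquilinear form of
`r`. Positivity and the GNS inner products are both read off from this form. -/
theorem densityPairing_star_mul (r : X → Matrix (Fin n) (Fin n) ℂ)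
    (a b : MatrixFunctionAlgebra n X) (x : X) :
    densityPairing r (star a * b) x = ∑ c, ∑ i, ∑ j, star (a c i x) * r x i j * b c j x := by
  have h1 : ∀ i j, (star a * b) i j x = ∑ c, star (a c i x) * b c j x := fun i j => by
    rw [CStarMatrix.mul_apply]
    simp [CStarMatrix.star_apply]
  simp only [densityPairing, h1, Finset.sum_mul]
  rw [eq_comm, Finset.sum_comm]
  refine Finset.sum_congr rfl fun i _ => ?_
  rw [Finset.sum_comm]
  exact Finset.sum_congr rfl fun j _ => Finset.sum_congr rfl fun c _ => by ring

variable [CompactSpace X] [MeasurableSpace X]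

namespace IsDensity

variable {φ : MatrixFunctionAlgebra n X →ₚ[ℂ] ℂ} {μ : Measure X}
  {r : X → Matrix (Fin n) (Fin n) ℂ}

theorem norm_apply_le_one (h : IsDensity φ μ r) (x : X) (i j : Fin n) : ‖r x i j‖ ≤ 1 := by
  have := (h.posSemidef x).norm_apply_le_trace i j
  rwa [h.trace_eq_one, Complex.one_re] at this

theorem densityPairing_star_mul_self_nonneg (h : IsDensity φ μ r) (a : MatrixFunctionAlgebra n X)
    (x : X) : 0 ≤ densityPairing r (star a * a) x := by
  rw [densityPairing_star_mul]
  exact Finset.sum_nonneg fun c _ => (h.posSemidef x).sum_nonneg fun i => a c i x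

variable [IsFiniteMeasure μ]

theorem integrable_apply (h : IsDensity φ μ r) (i j : Fin n) : Integrable (fun x => r x i j) μ :=
  Integrable.of_bound (h.measurable i j).aestronglyMeasurable 1
    (Filter.Eventually.of_forall fun x => h.norm_apply_le_one x i j)

variable [BorelSpace X]

theorem integrable_mul_apply (h : IsDensity φ μ r) (g : C(X, ℂ)) (i j : Fin n) :
    Integrable (fun x => g x * r x i j) μ :=
  (h.integrable_apply i j).bdd_mul g.continuous.aestronglyMeasurable
      (Filter.Eventually.of_forall fun x => g.norm_coe_le_norm x)

theorem integrable_densityPairing (h : IsDensity φ μ r) (a : MatrixFunctionAlgebra n X) :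
    Integrable (densityPairing r a) μ :=
  integrable_finsetSum _ fun i _ => integrable_finsetSum _ fun j _ => h.integrable_mul_apply _ i j

theorem apply_eq_integral (h : IsDensity φ μ r) (a : MatrixFunctionAlgebra n X) :
    φ a = ∫ x, densityPairing r a x ∂μ := by
  rw [h.apply_eq]
  simp only [densityPairing]
  refine Eq.symm ((integral_finsetSum _ fun i _ => integrable_finsetSum _ fun j _ =>
    h.integrable_mul_apply (a i j) i j).trans (Finset.sum_congr rfl fun i _ => ?_))
  exact integral_finsetSum _ fun j _ => h.integrable_mul_apply (a i j) i j

theorem apply_smul_eq_integral (h : IsDensity φ μ r) (g : C(X, ℂ))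
    (a : MatrixFunctionAlgebra n X) : φ (g • a) = ∫ x, g x * densityPairing r a x ∂μ := by
  rw [h.apply_eq_integral]
  congr 1; ext x
  simp [densityPairing, Finset.mul_sum, mul_assoc]

variable [T2Space X] [μ.Regular]

/-- Multiplication by a bounded measurable function is an operator in the bicommutant of the GNS
representation. -/
theorem exists_mem_gnsBicommutant (h : IsDensity φ μ r) {w : X → ℂ} (hw : Measurable w)
    (hw1 : ∀ x, ‖w x‖ ≤ 1) :
    ∃ S ∈ gnsBicommutant φ, ∀ a b : MatrixFunctionAlgebra n X,
      ⟪((φ.toPreGNS a : φ.PreGNS) : φ.GNS), S ((φ.toPreGNS b : φ.PreGNS) : φ.GNS)⟫_ℂ =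
        ∫ x, w x * densityPairing r (star a * b) x ∂μ := by
  obtain ⟨g, hg1, hg⟩ := exists_seq_continuousMap_tendsto_ae μ hw hw1
  let T : ℕ → φ.GNS →L[ℂ] φ.GNS := fun k => φ.gnsStarAlgHom (g k • 1)
  have hTapp : ∀ k (b : MatrixFunctionAlgebra n X),
      T k ((φ.toPreGNS b : φ.PreGNS) : φ.GNS) = ((φ.toPreGNS (g k • b) : φ.PreGNS) : φ.GNS) := by
    intro k b
    change φ.gnsNonUnitalStarAlgHom _ _ = _
    rw [PositiveLinearMap.gnsNonUnitalStarAlgHom_apply_coe]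
    simp
  have hnorm : ∀ (f : C(X, ℂ)) (b : MatrixFunctionAlgebra n X),
      ‖((φ.toPreGNS (f • b) : φ.PreGNS) : φ.GNS)‖ ^ 2 =
        ∫ x, ‖f x‖ ^ 2 * (densityPairing r (star b * b) x).re ∂μ := by
    intro f b
    rw [UniformSpace.Completion.norm_coe]
    have h1 := φ.preGNS_norm_sq (φ.toPreGNS (f • b))
    rw [PositiveLinearMap.ofPreGNS_toPreGNS] at h1
    have h2 : star (f • b) * (f • b) = (star f * f) • (star b * b) := by
      rw [star_smul, smul_mul_smul_comm]
    rw [h2, h.apply_smul_eq_integral] at h1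
    apply Complex.ofReal_injective
    rw [Complex.ofReal_pow, h1, ← integral_complex_ofReal]
    congr 1; ext x
    have h3 := (Complex.nonneg_iff.mp (h.densityPairing_star_mul_self_nonneg b x)).2
    have h4 : densityPairing r (star b * b) x = ((densityPairing r (star b * b) x).re : ℂ) :=
      Complex.ext rfl (by simpa using h3.symm)
    rw [h4]
    simp [Complex.conj_mul']
  have hDi : ∀ b : MatrixFunctionAlgebra n X,
      Integrable (fun x => (densityPairing r (star b * b) x).re) μ := fun b =>
    (h.integrable_densityPairing _).re
  have hD0 : ∀ (b : MatrixFunctionAlgebra n X) x, 0 ≤ (densityPairing r (star b * b) x).re :=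
    fun b x => (Complex.nonneg_iff.mp (h.densityPairing_star_mul_self_nonneg b x)).1
  have hmulint : ∀ (f : X → ℂ) (b : MatrixFunctionAlgebra n X) (C : ℝ), Measurable f →
      (∀ x, ‖f x‖ ^ 2 ≤ C) →
      Integrable (fun x => ‖f x‖ ^ 2 * (densityPairing r (star b * b) x).re) μ :=
    fun f b C hf hC => (hDi b).bdd_mul (hf.norm.pow_const 2).aestronglyMeasurable
      (Filter.Eventually.of_forall fun x => by
        rw [Real.norm_of_nonneg (by positivity)]; exact hC x)
  have hTbound : ∀ k x, ‖T k x‖ ≤ ‖x‖ := by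
    intro k x
    induction x using UniformSpace.Completion.induction_on with
    | hp => exact isClosed_le (by fun_prop) (by fun_prop)
    | ih b =>
      obtain ⟨b, rfl⟩ := φ.toPreGNS.surjective b
      rw [hTapp, ← sq_le_sq₀ (norm_nonneg _) (norm_nonneg _), hnorm]
      have h1 := hnorm 1 b
      rw [one_smul] at h1
      rw [h1]
      have hle : ∀ x, ‖g k x‖ ^ 2 ≤ 1 := fun x => pow_le_one₀ (norm_nonneg _) (hg1 k x)
      refine integral_mono (hmulint _ b 1 (g k).continuous.measurable hle)
        (hmulint _ b 1 (1 : C(X, ℂ)).continuous.measurable (by simp)) fun x => ?_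
      simp only [ContinuousMap.one_apply, norm_one, one_pow]
      exact mul_le_mul_of_nonneg_right (hle x) (hD0 b x)
  -- By `hnorm`, distances between the vectors T k b are L² distances between the g k for the
  -- measure μ weighted by the pairing of b* b, and in that space g k tends to `w`.
  have hcauchy : ∀ b : MatrixFunctionAlgebra n X,
      CauchySeq fun k => T k ((φ.toPreGNS b : φ.PreGNS) : φ.GNS) := by
    intro b
    have hsub4 : ∀ k x, ‖g k x - w x‖ ^ 2 ≤ 4 := fun k x => by
      have : ‖g k x - w x‖ ≤ 2 := (norm_sub_le _ _).trans (by linarith [hg1 k x, hw1 x])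
      nlinarith [norm_nonneg (g k x - w x)]
    have hi : ∀ k, Integrable
        (fun x => ‖g k x - w x‖ ^ 2 * (densityPairing r (star b * b) x).re) μ := fun k =>
      hmulint (fun x => g k x - w x) b 4 ((g k).continuous.measurable.sub hw) (hsub4 k)
    have hlim : Filter.Tendsto
        (fun k => ∫ x, ‖g k x - w x‖ ^ 2 * (densityPairing r (star b * b) x).re ∂μ)
        Filter.atTop (𝓝 0) := by
      have h0 : (0 : ℝ) = ∫ x : X, (0 : ℝ) ∂μ := by simp
      rw [h0]
      refine tendsto_integral_of_dominated_convergence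
        (fun x => 4 * (densityPairing r (star b * b) x).re) (fun k => (hi k).aestronglyMeasurable)
        ((hDi b).const_mul 4) (fun k => Filter.Eventually.of_forall fun x => ?_) ?_
      · rw [Real.norm_of_nonneg (mul_nonneg (by positivity) (hD0 b x))]
        exact mul_le_mul_of_nonneg_right (hsub4 k x) (hD0 b x)
      · filter_upwards [hg] with x hx
        have h1 := ((hx.sub_const (w x)).norm.pow 2).mul_const (densityPairing r (star b * b) x).re
        simpa using h1
    rw [Metric.cauchySeq_iff']
    intro ε hε
    -- The bound |a - b|² ≤ 2|a - w|² + 2|b - w|² below turns two errors less than ε²/4 into one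
    -- less than ε².
    obtain ⟨N, hN⟩ := Filter.eventually_atTop.mp
      (hlim.eventually_lt_const (show (0 : ℝ) < ε ^ 2 / 4 by positivity))
    refine ⟨N, fun k hk => ?_⟩
    rw [dist_eq_norm, hTapp, hTapp, ← UniformSpace.Completion.coe_sub, ← map_sub, ← sub_smul,
      ← sq_lt_sq₀ (norm_nonneg _) hε.le, hnorm]
    calc ∫ x, ‖(g k - g N) x‖ ^ 2 * (densityPairing r (star b * b) x).re ∂μ
        ≤ ∫ x, (2 * (‖g k x - w x‖ ^ 2 * (densityPairing r (star b * b) x).re) +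
            2 * (‖g N x - w x‖ ^ 2 * (densityPairing r (star b * b) x).re)) ∂μ := by
          refine integral_mono_of_nonneg (Filter.Eventually.of_forall fun x =>
            mul_nonneg (by positivity) (hD0 b x)) (((hi k).const_mul 2).add ((hi N).const_mul 2))
            (Filter.Eventually.of_forall fun x => ?_)
          have h1 : ‖(g k - g N) x‖ ≤ ‖g k x - w x‖ + ‖g N x - w x‖ := by
            have : (g k - g N) x = (g k x - w x) - (g N x - w x) := by simp
            rw [this]; exact norm_sub_le _ _
          have h2 : ‖(g k - g N) x‖ ^ 2 ≤ 2 * ‖g k x - w x‖ ^ 2 + 2 * ‖g N x - w x‖ ^ 2 := by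
            nlinarith [norm_nonneg ((g k - g N) x), sq_nonneg (‖g k x - w x‖ - ‖g N x - w x‖)]
          have h3 := mul_le_mul_of_nonneg_right h2 (hD0 b x)
          dsimp only
          linarith
      _ < ε ^ 2 := by
          rw [integral_add ((hi k).const_mul 2) ((hi N).const_mul 2), integral_const_mul,
            integral_const_mul]
          linarith [hN k hk, hN N le_rfl]
  have hdense : DenseRange fun b : MatrixFunctionAlgebra n X =>
      ((φ.toPreGNS b : φ.PreGNS) : φ.GNS) :=
    UniformSpace.Completion.denseRange_coe.comp φ.toPreGNS.surjective.denseRange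
      (UniformSpace.Completion.continuous_coe _)
  obtain ⟨S, hS⟩ := exists_strong_limit_of_cauchySeq T hTbound _ hdense hcauchy
  refine ⟨S, ?_, fun a b => ?_⟩
  -- Commuting with a bounded operator passes to strong limits.
  · rw [gnsBicommutant, Set.mem_centralizer_iff]
    intro N hN
    rw [Set.mem_centralizer_iff] at hN
    ext x
    have h1 : Filter.Tendsto (fun k => N (T k x)) Filter.atTop (𝓝 (N (S x))) :=
      (N.continuous.tendsto _).comp (hS x)
    have h2 : ∀ k, N (T k x) = T k (N x) := fun k =>
      (DFunLike.congr_fun (hN (T k) ⟨_, rfl⟩) x).symm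
    simp only [h2] at h1
    exact tendsto_nhds_unique h1 (hS (N x))
  · have h1 : Filter.Tendsto (fun k => ⟪((φ.toPreGNS a : φ.PreGNS) : φ.GNS),
        T k ((φ.toPreGNS b : φ.PreGNS) : φ.GNS)⟫_ℂ) Filter.atTop
        (𝓝 ⟪((φ.toPreGNS a : φ.PreGNS) : φ.GNS), S ((φ.toPreGNS b : φ.PreGNS) : φ.GNS)⟫_ℂ) :=
      tendsto_const_nhds.inner (hS _)
    have h2 : ∀ k, ⟪((φ.toPreGNS a : φ.PreGNS) : φ.GNS),
        T k ((φ.toPreGNS b : φ.PreGNS) : φ.GNS)⟫_ℂ =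
        ∫ x, g k x * densityPairing r (star a * b) x ∂μ := by
      intro k
      rw [hTapp, UniformSpace.Completion.inner_coe, PositiveLinearMap.preGNS_inner_def,
        PositiveLinearMap.ofPreGNS_toPreGNS, PositiveLinearMap.ofPreGNS_toPreGNS,
        ← h.apply_smul_eq_integral]
      congr 1
      exact mul_smul_comm _ _ _
    simp only [h2] at h1
    refine tendsto_nhds_unique h1 ?_
    refine tendsto_integral_of_dominated_convergence
      (fun x => ‖densityPairing r (star a * b) x‖)
      (fun k => (g k).continuous.aestronglyMeasurable.mul
        (h.integrable_densityPairing _).aestronglyMeasurable)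
      (h.integrable_densityPairing _).norm (fun k => Filter.Eventually.of_forall fun x => ?_) ?_
    · rw [norm_mul]
      exact mul_le_of_le_one_left (norm_nonneg _) (hg1 k x)
    · filter_upwards [hg] with x hx
      exact hx.mul_const _

end IsDensity

end Faithful

/-! ### Faithfulness forces an invertible density -/

section Nondegenerate

open MeasureTheory

theorem Measurable.matrix_pow_apply {X ι : Type*} [MeasurableSpace X] [Fintype ι] [DecidableEq ι]
    {f : X → Matrix ι ι ℂ} (hf : ∀ i j, Measurable fun x => f x i j) (m : ℕ) (i j : ι) :
    Measurable fun x => (f x ^ m) i j := by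
  induction m generalizing i j with
  | zero => simp
  | succ m ih =>
    simp only [pow_succ, Matrix.mul_apply]
    exact Finset.measurable_sum _ fun k _ => (ih i k).mul (hf k j)

section Bicommutant

variable {A : Type*} [CStarAlgebra A] [PartialOrder A] [StarOrderedRing A] (φ : A →ₚ[ℂ] ℂ)

theorem gnsStarAlgHom_apply_toPreGNS (a b : A) :
    φ.gnsStarAlgHom a ((φ.toPreGNS b : φ.PreGNS) : φ.GNS) =
      ((φ.toPreGNS (a * b) : φ.PreGNS) : φ.GNS) := by
  change φ.gnsNonUnitalStarAlgHom _ _ = _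
  rw [PositiveLinearMap.gnsNonUnitalStarAlgHom_apply_coe]
  simp

theorem star_mem_gnsBicommutant {S : φ.GNS →L[ℂ] φ.GNS} (hS : S ∈ gnsBicommutant φ) :
    star S ∈ gnsBicommutant φ := by
  refine Set.star_mem_centralizer' (fun N hN => Set.star_mem_centralizer' ?_ hN) hS
  rintro _ ⟨a, rfl⟩
  exact ⟨star a, map_star _ _⟩

/-- If the GNS vector state is faithful, the GNS vector is separating for the bicommutant. -/
theorem IsGNSFaithful.eq_zero_of_apply_gnsVector_eq_zero {φ : A →ₚ[ℂ] ℂ} (hφ : IsGNSFaithful φ)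
    {S : φ.GNS →L[ℂ] φ.GNS} (hS : S ∈ gnsBicommutant φ) (h0 : S (gnsVector φ) = 0) : S = 0 := by
  rw [← CStarRing.star_mul_self_eq_zero_iff]
  refine hφ _ (Set.mul_mem_centralizer (star_mem_gnsBicommutant φ hS) hS) ?_ ?_
  · rw [← ContinuousLinearMap.nonneg_iff_isPositive]
    exact star_mul_self_nonneg S
  · rw [mul_apply_eq_comp, h0, map_zero, inner_zero_right]

end Bicommutant

variable {X : Type u} [TopologicalSpace X] [CompactSpace X] [T2Space X] [MeasurableSpace X]
  [BorelSpace X] {n : ℕ} {φ : MatrixFunctionAlgebra n X →ₚ[ℂ] ℂ} {μ : Measure X}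
  {r : X → Matrix (Fin n) (Fin n) ℂ} [IsFiniteMeasure μ] [μ.Regular]

/-- If `φ` is GNS-faithful, a bounded measurable matrix-valued function that annihilates the density
vanishes almost everywhere. -/
theorem IsDensity.ae_eq_zero_of_sum_mul_eq_zero (h : IsDensity φ μ r) (hφ : IsGNSFaithful φ)
    {w : Fin n → Fin n → X → ℂ} (hw : ∀ i j, Measurable (w i j)) (hw1 : ∀ i j x, ‖w i j x‖ ≤ 1)
    (hwr : ∀ i a x, ∑ j, w i j x * r x a j = 0) (i j : Fin n) : ∀ᵐ x ∂μ, w i j x = 0 := by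
  choose M hM hMin using fun i j => h.exists_mem_gnsBicommutant (hw i j) (hw1 i j)
  have hwi : ∀ i j (a : MatrixFunctionAlgebra n X),
      Integrable (fun x => w i j x * densityPairing r a x) μ := fun i j a =>
    (h.integrable_densityPairing a).bdd_mul (hw i j).aestronglyMeasurable
      (Filter.Eventually.of_forall (hw1 i j))
  -- `Q` plays the role of left multiplication by the matrix function `w`, although `w` need not be
  -- continuous.
  let Q : φ.GNS →L[ℂ] φ.GNS := ∑ i, ∑ j, M i j * φ.gnsStarAlgHom (matUnit i j 1)
  have hQmem : Q ∈ gnsBicommutant φ := by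
    have hB : ∀ S, S ∈ gnsBicommutant φ ↔
        S ∈ Subalgebra.centralizer ℂ (Set.range φ.gnsStarAlgHom).centralizer := fun _ => Iff.rfl
    rw [hB]
    refine Subalgebra.sum_mem _ fun i _ => Subalgebra.sum_mem _ fun j _ =>
      Subalgebra.mul_mem _ ((hB _).mp (hM i j)) ((hB _).mp ?_)
    exact Set.subset_centralizer_centralizer ⟨_, rfl⟩
  have hQapp : ∀ b : MatrixFunctionAlgebra n X, Q ((φ.toPreGNS b : φ.PreGNS) : φ.GNS) =
      ∑ i, ∑ j, M i j ((φ.toPreGNS (matUnit i j 1 * b) : φ.PreGNS) : φ.GNS) := by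
    intro b
    simp only [Q, sum_apply, mul_apply_eq_comp,
      gnsStarAlgHom_apply_toPreGNS]
  have hQ0 : Q = 0 := by
    refine hφ.eq_zero_of_apply_gnsVector_eq_zero hQmem ?_
    have hin : ∀ y, ⟪y, Q (gnsVector φ)⟫_ℂ = 0 := by
      intro y
      induction y using UniformSpace.Completion.induction_on with
      | hp => exact isClosed_eq (by fun_prop) continuous_const
      | ih b =>
        obtain ⟨b, rfl⟩ := φ.toPreGNS.surjective b
        rw [gnsVector, hQapp]
        simp only [inner_sum, hMin, mul_one]
        refine Finset.sum_eq_zero fun i _ => ?_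
        rw [← integral_finsetSum _ fun j _ => hwi i j _]
        have : ∀ x, ∑ j, w i j x * densityPairing r (star b * matUnit i j 1) x = 0 := by
          intro x
          have h1 : ∀ j, densityPairing r (star b * matUnit i j 1) x =
              ∑ a, star (b i a x) * r x a j := by
            intro j
            rw [densityPairing_star_mul, Finset.sum_eq_single i]
            · refine Finset.sum_congr rfl fun a _ => ?_
              rw [Finset.sum_eq_single j]
              · simp [matUnit_apply]
              · intro k _ hk
                simp [matUnit_apply, hk.symm]
              · simp
            · intro c _ hc
              simp [matUnit_apply, hc.symm]
            · simp
          simp only [h1, Finset.mul_sum]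
          rw [Finset.sum_comm]
          refine Finset.sum_eq_zero fun a _ => ?_
          have h2 := congrArg (fun z => star (b i a x) * z) (hwr i a x)
          simp only [mul_zero, Finset.mul_sum] at h2
          rw [← h2]
          exact Finset.sum_congr rfl fun j _ => by ring
        simp only [this, integral_zero]
    exact inner_self_eq_zero.mp (hin _)
  refine ae_eq_zero_of_forall_integral_continuousMap_mul_eq_zero
    (Integrable.of_bound (hw i j).aestronglyMeasurable 1 (Filter.Eventually.of_forall (hw1 i j)))
    fun f => ?_
  -- The matrix coefficient of `Q` between suitable matrix units isolates the entry `w i j` against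
  -- r_pp; summing over p removes the density, because its trace is one.
  have hp : ∀ p, ∫ x, w i j x * densityPairing r (matUnit p p f) x ∂μ = 0 := by
    intro p
    have h1 : ⟪((φ.toPreGNS (matUnit i p (star f)) : φ.PreGNS) : φ.GNS),
        Q ((φ.toPreGNS (matUnit j p 1) : φ.PreGNS) : φ.GNS)⟫_ℂ = 0 := by
      rw [hQ0]; simp
    rw [hQapp] at h1
    simp only [inner_sum, hMin, star_matUnit, star_star, matUnit_mul_matUnit] at h1
    rw [Finset.sum_eq_single i, Finset.sum_eq_single j] at h1
    · simpa [matUnit_mul_matUnit] using h1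
    · intro b _ hb
      simp [hb, densityPairing]
    · simp
    · intro b _ hb
      refine Finset.sum_eq_zero fun c _ => ?_
      by_cases hc : c = j
      · simp [hc, matUnit_mul_matUnit, hb.symm, densityPairing]
      · simp [hc, densityPairing]
    · simp
  have h2 : ∀ x, f x * w i j x = ∑ p, w i j x * densityPairing r (matUnit p p f) x := by
    intro x
    have h3 : ∀ p, densityPairing r (matUnit p p f) x = f x * r x p p := by
      intro p
      rw [densityPairing, Finset.sum_eq_single p, Finset.sum_eq_single p]
      · simp [matUnit_apply]
      · intro b _ hb; simp [matUnit_apply, hb.symm]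
      · simp
      · intro b _ hb; simp [matUnit_apply, hb.symm]
      · simp
    have htr : ∑ p, r x p p = 1 := h.trace_eq_one x
    simp only [h3]
    rw [← Finset.mul_sum, ← Finset.mul_sum, htr, mul_one, mul_comm]
  simp only [h2]
  rw [integral_finsetSum _ fun p _ => hwi i j _]
  exact Finset.sum_eq_zero fun p _ => hp p

/-- The density of a GNS-faithful state is almost everywhere invertible. -/
theorem IsDensity.ae_det_ne_zero (h : IsDensity φ μ r) (hφ : IsGNSFaithful φ) :
    ∀ᵐ x ∂μ, (r x).det ≠ 0 := by
  choose q hq hqr hq0 using fun x =>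
    (h.posSemidef x).exists_tendsto_one_sub_pow (h.trace_eq_one x)
  have hqm : ∀ i j, Measurable fun x => q x i j := by
    intro i j
    -- Obtaining `q` as a limit of powers makes it measurable without any measurable choice of
    -- eigenvectors.
    refine measurable_of_tendsto_metrizable (f := fun m x => ((1 - r x) ^ m) i j) (fun m => ?_) ?_
    · refine Measurable.matrix_pow_apply (fun a b => ?_) m i j
      simp only [Matrix.sub_apply]
      exact measurable_const.sub (h.measurable a b)
    · rw [tendsto_pi_nhds]
      intro x
      exact tendsto_pi_nhds.mp (tendsto_pi_nhds.mp (hq x) i) j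
  let s : X → ℝ := fun x => 1 + ∑ i, ∑ j, ‖q x i j‖
  have hs0 : ∀ x, 0 < s x := fun x => by positivity
  have hsm : Measurable s := measurable_const.add
    (Finset.measurable_sum _ fun i _ => Finset.measurable_sum _ fun j _ => (hqm i j).norm)
  -- The pairing has no transpose, so the condition is that `w` annihilates the transpose of `r`. As
  -- `r` is Hermitian, this is the conjugate of q r = 0, whence the `star`. Division by `s` only
  -- serves the bound by 1.
  have hzero := fun i j => h.ae_eq_zero_of_sum_mul_eq_zero hφ
    (w := fun i j x => star (q x i j) / (s x : ℂ))
    (fun i j => (continuous_star.measurable.comp (hqm i j)).div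
      (Complex.measurable_ofReal.comp hsm))
    (fun i j x => by
      rw [norm_div, norm_star, Complex.norm_real, Real.norm_of_nonneg (hs0 x).le,
        div_le_one (hs0 x)]
      have h1 : ‖q x i j‖ ≤ ∑ j, ‖q x i j‖ :=
        Finset.single_le_sum (f := fun j => ‖q x i j‖) (fun _ _ => norm_nonneg _)
          (Finset.mem_univ j)
      have h2 : ∑ j, ‖q x i j‖ ≤ ∑ i, ∑ j, ‖q x i j‖ :=
        Finset.single_le_sum (f := fun i => ∑ j, ‖q x i j‖)
          (fun _ _ => Finset.sum_nonneg fun _ _ => norm_nonneg _) (Finset.mem_univ i)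
      simp only [s]
      linarith)
    (fun i a x => by
      have h1 := congrFun (congrFun (hqr x) i) a
      rw [Matrix.mul_apply, Matrix.zero_apply] at h1
      have h2 : ∀ j, r x a j = star (r x j a) := fun j =>
        ((h.posSemidef x).1.apply a j).symm
      have h3 := congrArg (fun z => star z / (s x : ℂ)) h1
      simp only [star_sum, star_mul', star_zero, zero_div, Finset.sum_div] at h3
      rw [← h3]
      exact Finset.sum_congr rfl fun j _ => by rw [h2]; ring) i j
  have hall := ae_all_iff.mpr fun i => ae_all_iff.mpr fun j => hzero i j
  filter_upwards [hall] with x hx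
  refine hq0 x (Matrix.ext fun i j => ?_)
  have h1 := hx i j
  rw [div_eq_zero_iff] at h1
  rcases h1 with h1 | h1
  · simpa using h1
  · exact absurd (Complex.ofReal_eq_zero.mp h1) (hs0 x).ne'

end Nondegenerate

/-! ### Partitions of unity, level sets and averages -/

section PartitionsAndWeights

open MeasureTheory

/-- A neighbourhood assignment on a compact Hausdorff space has a subordinate finite partition of
unity. -/
theorem exists_finite_partition_of_unity {X : Type*} [TopologicalSpace X] [CompactSpace X]
    [T2Space X] {W : X → Set X}
    (hW : ∀ x, IsOpen (W x)) (hxW : ∀ x, x ∈ W x) :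
    ∃ (N : ℕ) (p : Fin N → X) (f : Fin N → C(X, ℝ)), (∀ k x, 0 ≤ f k x) ∧
      (∀ x, ∑ k, f k x = 1) ∧ ∀ k x, f k x ≠ 0 → x ∈ W (p k) := by
  obtain ⟨t, ht⟩ := CompactSpace.elim_nhds_subcover W fun x => (hW x).mem_nhds (hxW x)
  let p : Fin t.card → X := fun k => (t.equivFin.symm k : X)
  have hcov : (Set.univ : Set X) ⊆ ⋃ k, W (p k) := by
    intro x _
    obtain ⟨y, hy, hxy⟩ := Set.mem_iUnion₂.mp (ht.symm.le (Set.mem_univ x))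
    exact Set.mem_iUnion.mpr ⟨t.equivFin ⟨y, hy⟩, by simpa [p] using hxy⟩
  obtain ⟨f, hf1, hf2, hf3, -⟩ :=
    exists_continuous_sum_one_of_isOpen_isCompact (fun k => hW (p k)) isCompact_univ hcov
  refine ⟨_, p, f, fun k x => (hf3 k x).1, fun x => ?_, fun k x hx => ?_⟩
  · simpa using hf2 (Set.mem_univ x)
  · exact hf1 k (subset_tsupport _ hx)

variable {X : Type*} [MeasurableSpace X] {μ : Measure X}

/-- Continuity of the measure from above along the sets {q < 1/(m+1)}, whose intersection is null.
-/
theorem exists_pos_measure_lt_le [IsFiniteMeasure μ] {q : X → ℝ} (hq : Measurable q)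
    (hpos : ∀ᵐ x ∂μ, 0 < q x) {η : ℝ} (hη : 0 < η) :
    ∃ c : ℝ, 0 < c ∧ μ.real {x | q x < c} ≤ η := by
  have h := tendsto_measure_iInter_atTop (μ := μ) (s := fun m : ℕ => {x | q x < 1 / ((m : ℝ) + 1)})
    (fun m => (measurableSet_lt hq measurable_const).nullMeasurableSet)
    (fun a b hab x (hx : q x < _) => hx.trans_le (Nat.one_div_le_one_div hab))
    ⟨0, measure_ne_top _ _⟩
  have h0 : μ (⋂ m : ℕ, {x | q x < 1 / ((m : ℝ) + 1)}) = 0 := by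
    refine measure_mono_null (fun x hx => ?_) (ae_iff.mp hpos)
    intro h0
    obtain ⟨m, hm⟩ := exists_nat_one_div_lt h0
    exact lt_asymm hm (Set.mem_iInter.mp hx m)
  rw [h0] at h
  have h1 := (ENNReal.tendsto_toReal ENNReal.zero_ne_top).comp h
  obtain ⟨m, hm⟩ := (h1.eventually_le_const hη).exists
  exact ⟨_, Nat.one_div_pos_of_nat, hm⟩

/-- Up to a null set, U_i is the union of its parts where q ≥ 1/(m+1), so one of these has positive
measure if U_i does. Finiteness of `t` permits one γ, small enough to be both the level and the
lower bound for the mass. -/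
theorem exists_pos_forall_le_measure_inter_le [IsFiniteMeasure μ] {q : X → ℝ}
    (hpos : ∀ᵐ x ∂μ, 0 < q x) {ι : Type*} (t : Finset ι) (U : ι → Set X) :
    ∃ γ : ℝ, 0 < γ ∧ ∀ i ∈ t, μ (U i) ≠ 0 → γ ≤ μ.real (U i ∩ {x | γ ≤ q x}) := by
  have h : ∀ᶠ γ in 𝓝[>] (0 : ℝ),
      ∀ i ∈ t, μ (U i) ≠ 0 → γ ≤ μ.real (U i ∩ {x | γ ≤ q x}) := by
    rw [Filter.eventually_all_finset]
    intro i _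
    by_cases hi : μ (U i) = 0
    · simp [hi]
    obtain ⟨m, hm⟩ : ∃ m : ℕ, μ (U i ∩ {x | 1 / ((m : ℝ) + 1) ≤ q x}) ≠ 0 := by
      by_contra! hcon
      refine hi (le_antisymm ?_ bot_le)
      calc μ (U i) ≤ μ ((⋃ m : ℕ, U i ∩ {x | 1 / ((m : ℝ) + 1) ≤ q x}) ∪ {x | ¬ 0 < q x}) := by
            refine measure_mono fun x hx => ?_
            by_cases h0 : 0 < q x
            · obtain ⟨m, hm⟩ := exists_nat_one_div_lt h0
              exact Or.inl (Set.mem_iUnion.mpr ⟨m, hx, hm.le⟩)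
            · exact Or.inr h0
        _ ≤ 0 := (measure_union_null (measure_iUnion_null hcon) (ae_iff.mp hpos)).le
    have hm' : 0 < μ.real (U i ∩ {x | 1 / ((m : ℝ) + 1) ≤ q x}) :=
      ENNReal.toReal_pos hm (measure_ne_top _ _)
    filter_upwards [Ioc_mem_nhdsGT (lt_min hm' (Nat.one_div_pos_of_nat (α := ℝ) (n := m)))]
      with γ hγ _
    refine (hγ.2.trans (min_le_left _ _)).trans (measureReal_mono ?_)
    exact fun x hx => ⟨hx.1, (hγ.2.trans (min_le_right _ _)).trans hx.2⟩
  obtain ⟨γ, hγ, h0⟩ := (h.and self_mem_nhdsWithin).exists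
  exact ⟨γ, h0, hγ⟩

variable [TopologicalSpace X]

variable [CompactSpace X] [BorelSpace X]
  {E : Type*} [NormedAddCommGroup E] [NormedSpace ℝ E] {R : X → E}

theorem ContinuousMap.integrable_mul_real (f : C(X, ℝ)) {g : X → ℝ} (hg : Integrable g μ) :
    Integrable (fun x => f x * g x) μ :=
  hg.bdd_mul f.continuous.aestronglyMeasurable
    (Filter.Eventually.of_forall fun x => f.norm_coe_le_norm x)

theorem ContinuousMap.integrable_smul_real (f : C(X, ℝ)) (hR : Integrable R μ) :
    Integrable (fun x => f x • R x) μ :=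
  hR.bdd_smul _ f.continuous.aestronglyMeasurable
    (Filter.Eventually.of_forall fun x => f.norm_coe_le_norm x)

variable [IsFiniteMeasure μ] [CompleteSpace E]

/-- The averages of `R` over a partition of unity approximate `R` in mean as soon as `R` is close in
mean to a function that oscillates little on each piece. -/
theorem integral_sum_mul_norm_average_sub_le (hR : Integrable R μ) {h : X → E}
    (hh : Integrable h μ) {N : ℕ} {f : Fin N → C(X, ℝ)} (hf : ∀ k x, 0 ≤ f k x)
    (hf1 : ∀ x, ∑ k, f k x = 1) {y : Fin N → E} {δ : ℝ}
    (hy : ∀ k x, f k x ≠ 0 → ‖h x - y k‖ ≤ δ) :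
    ∫ x, ∑ k, f k x * ‖(∫ z, f k z ∂μ)⁻¹ • (∫ z, f k z • R z ∂μ) - R x‖ ∂μ ≤
      2 * (∫ x, ‖R x - h x‖ ∂μ + δ * μ.real Set.univ) := by
  set v : Fin N → E := fun k => (∫ z, f k z ∂μ)⁻¹ • (∫ z, f k z • R z ∂μ)
  have hi1 : ∀ k (c : E), Integrable (fun x => f k x * ‖c - R x‖) μ := fun k c =>
    (f k).integrable_mul_real ((integrable_const c).sub hR).norm
  have hi2 : ∀ k, Integrable (fun x => f k x * (‖R x - h x‖ + δ)) μ := fun k =>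
    (f k).integrable_mul_real ((hR.sub hh).norm.add (integrable_const δ))
  -- The distance from `R` to its average is compared with the distance from `R` to the constant y
  -- k. The average moves from y k by no more than the mean of that same distance, which accounts
  -- for the factor 2.
  have key : ∀ k, ∫ x, f k x * ‖v k - R x‖ ∂μ ≤ 2 * ∫ x, f k x * (‖R x - h x‖ + δ) ∂μ := by
    intro k
    have h1 : ∫ x, f k x * ‖y k - R x‖ ∂μ ≤ ∫ x, f k x * (‖R x - h x‖ + δ) ∂μ := by
      refine integral_mono (hi1 k _) (hi2 k) fun x => ?_
      by_cases h0 : f k x = 0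
      · simp [h0]
      refine mul_le_mul_of_nonneg_left ?_ (hf k x)
      calc ‖y k - R x‖ = ‖(R x - h x) + (h x - y k)‖ := by rw [norm_sub_rev]; congr 1; abel
        _ ≤ _ := (norm_add_le _ _).trans (add_le_add_right (hy k x h0) _)
    have h2 : (∫ x, f k x ∂μ) * ‖v k - y k‖ ≤ ∫ x, f k x * ‖y k - R x‖ ∂μ := by
      by_cases hm : ∫ x, f k x ∂μ = 0
      · rw [hm, zero_mul]
        exact integral_nonneg fun x => mul_nonneg (hf k x) (norm_nonneg _)
      have h3 : (∫ x, f k x ∂μ) • (v k - y k) = ∫ x, f k x • (R x - y k) ∂μ := by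
        simp only [smul_sub, v]
        rw [smul_inv_smul₀ hm, integral_sub ((f k).integrable_smul_real hR)
          ((f k).integrable_smul_real (integrable_const _)), integral_smul_const]
      rw [← Real.norm_of_nonneg (integral_nonneg (hf k) : 0 ≤ ∫ x, f k x ∂μ), ← norm_smul, h3]
      refine (norm_integral_le_integral_norm _).trans_eq (integral_congr_ae ?_)
      refine Filter.Eventually.of_forall fun x => ?_
      simp only [norm_smul, Real.norm_of_nonneg (hf k x), norm_sub_rev (R x)]
    calc ∫ x, f k x * ‖v k - R x‖ ∂μ
        ≤ ∫ x, (f k x * ‖v k - y k‖ + f k x * ‖y k - R x‖) ∂μ := by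
          refine integral_mono (hi1 k _)
            (((f k).integrable_mul_real (integrable_const _)).add (hi1 k _)) fun x => ?_
          change _ ≤ f k x * ‖v k - y k‖ + f k x * ‖y k - R x‖
          rw [← mul_add]
          refine mul_le_mul_of_nonneg_left ?_ (hf k x)
          exact norm_sub_le_norm_sub_add_norm_sub _ _ _
      _ = (∫ x, f k x ∂μ) * ‖v k - y k‖ + ∫ x, f k x * ‖y k - R x‖ ∂μ := by
          rw [integral_add ((f k).integrable_mul_real (integrable_const _)) (hi1 k _),
            integral_mul_const]
      _ ≤ _ := by linarith
  calc ∫ x, ∑ k, f k x * ‖v k - R x‖ ∂μ = ∑ k, ∫ x, f k x * ‖v k - R x‖ ∂μ :=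
        integral_finsetSum _ fun k _ => hi1 k _
    _ ≤ ∑ k, 2 * ∫ x, f k x * (‖R x - h x‖ + δ) ∂μ := Finset.sum_le_sum fun k _ => key k
    _ = 2 * ∫ x, ∑ k, f k x * (‖R x - h x‖ + δ) ∂μ := by
        rw [integral_finsetSum _ fun k _ => hi2 k, Finset.mul_sum]
    _ = _ := by
        simp only [← Finset.sum_mul, hf1, one_mul]
        rw [integral_add (f := fun x => ‖R x - h x‖) (hR.sub hh).norm (integrable_const δ),
          integral_const, smul_eq_mul, mul_comm δ]

end PartitionsAndWeights

/-! ### Redistributing mass to dominate pointwise -/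

section Weights

open MeasureTheory

variable {X : Type*} [TopologicalSpace X] [CompactSpace X] [T2Space X] [MeasurableSpace X]
  [BorelSpace X] {μ : Measure X} [IsProbabilityMeasure μ]
  {E : Type*} [NormedAddCommGroup E] [NormedSpace ℝ E] [CompleteSpace E] {R : X → E}

/-- For every finite set of continuous functions there is a partition of unity of small oscillation
whose averages of `R` approximate `R` in mean. The pieces are indexed through a coarser cover
that depends on the finite set only. -/
theorem exists_partition_of_unity_average_approx [μ.Regular] (hR : Integrable R μ)
    {ι : Type*} {i : X → ι} {U : ι → Set X} (hU : ∀ j, IsOpen (U j)) (hi : ∀ x, x ∈ U (i x))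
    {δ : ℝ} (hδ : 0 < δ) :
    ∃ (N : ℕ) (p : Fin N → X) (f : Fin N → C(X, ℝ)), (∀ k x, 0 ≤ f k x) ∧
      (∀ x, ∑ k, f k x = 1) ∧ (∀ k x, f k x ≠ 0 → x ∈ U (i (p k))) ∧
      ∫ x, ∑ k, f k x * ‖(∫ z, f k z ∂μ)⁻¹ • (∫ z, f k z • R z ∂μ) - R x‖ ∂μ ≤ δ := by
  obtain ⟨h, hh, hhi⟩ := hR.exists_boundedContinuous_integral_sub_le (show 0 < δ / 4 by positivity)
  -- The pieces refine the given cover and make `h` oscillate by less than δ/4; together with the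
  -- approximation error δ/4, the factor 2 gives δ.
  obtain ⟨N, p, f, hf, hf1, hfs⟩ := exists_finite_partition_of_unity
    (W := fun x => U (i x) ∩ {y | ‖h y - h x‖ < δ / 4})
    (fun x => (hU _).inter (isOpen_lt ((h.continuous.sub continuous_const).norm) continuous_const))
    (fun x => ⟨hi x, by simpa using hδ⟩)
  refine ⟨N, p, f, hf, hf1, fun k x hx => (hfs k x hx).1, ?_⟩
  have := integral_sum_mul_norm_average_sub_le hR hhi hf hf1 (y := fun k => h (p k))
    (fun k x hx => (hfs k x hx).2.le)
  rw [probReal_univ] at this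
  linarith

/-- The weights: a partition of unity `f`, weights `ρ` of the same masses and vectors `v` that are
the averages of `R` over `f`, such that `∑ ρ k • v k` is dominated by `R` up to an error
controlled by `q`. -/
theorem exists_partition_of_unity_and_weights [μ.Regular] (hRm : StronglyMeasurable R)
    (hR1 : ∀ x, ‖R x‖ ≤ 1) {q : X → ℝ} (hq : Measurable q) (hq0 : ∀ x, 0 ≤ q x)
    (hpos : ∀ᵐ x ∂μ, 0 < q x) (F : Finset C(X, ℂ)) {ε : ℝ} (hε : 0 < ε) :
    ∃ (N : ℕ) (p : Fin N → X) (f : Fin N → C(X, ℝ)) (ρ : Fin N → X → ℝ) (v : Fin N → E),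
      (∀ k x, 0 ≤ f k x) ∧ (∀ x, ∑ k, f k x = 1) ∧
      (∀ k, Integrable (ρ k) μ) ∧ (∀ k x, 0 ≤ ρ k x) ∧ (∀ k, ∫ x, ρ k x ∂μ = ∫ x, f k x ∂μ) ∧
      (∀ k, ∫ x, f k x • R x ∂μ = (∫ x, f k x ∂μ) • v k) ∧
      (∀ g ∈ F, ∀ k x, f k x ≠ 0 → ‖g (p k) - g x‖ ≤ ε ∧ ∀ y, ρ k y ≠ 0 → ‖g y - g x‖ ≤ ε) ∧
      ∀ x, ∃ s : ℝ, s ≤ 1 ∧ ‖∑ k, ρ k x • v k - s • R x‖ ≤ ε * q x := by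
  classical
  have hR : Integrable R μ :=
    Integrable.of_bound hRm.aestronglyMeasurable 1 (Filter.Eventually.of_forall hR1)
  -- the coarse cover
  let U : X → Set X := fun x => ⋂ g ∈ F, {y | ‖g y - g x‖ < ε / 2}
  have hU : ∀ x, IsOpen (U x) := fun x => isOpen_biInter_finset fun g _ =>
    isOpen_lt ((g.continuous.sub continuous_const).norm) continuous_const
  have hxU : ∀ x, x ∈ U x := fun x => Set.mem_iInter₂.mpr fun g _ => by simpa using hε
  have hosc : ∀ j, ∀ g ∈ F, ∀ x ∈ U j, ∀ y ∈ U j, ‖g y - g x‖ ≤ ε := by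
    intro j g hg x hx y hy
    have h1 : ‖g x - g j‖ < ε / 2 := Set.mem_iInter₂.mp hx g hg
    have h2 : ‖g y - g j‖ < ε / 2 := Set.mem_iInter₂.mp hy g hg
    have := norm_sub_le_norm_sub_add_norm_sub (g y) (g j) (g x)
    rw [norm_sub_rev (g j)] at this
    linarith
  obtain ⟨t, ht⟩ := CompactSpace.elim_nhds_subcover U fun x => (hU x).mem_nhds (hxU x)
  have hcov : ∀ x, ∃ j ∈ t, x ∈ U j := fun x => by
    simpa using ht.symm.le (Set.mem_univ x)
  choose i hit hi using hcov
  -- γ depends on the coarse cover alone, so the threshold `c` and the fine partition may be chosen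
  -- in terms of it.
  obtain ⟨γ, hγ, hγU⟩ := exists_pos_forall_le_measure_inter_le hpos t U
  obtain ⟨c, hc, hcμ⟩ := exists_pos_measure_lt_le (μ := μ) hq hpos
    (show 0 < ε * γ ^ 2 / 4 by positivity)
  obtain ⟨N, p, f, hf, hf1, hfs, hG⟩ := exists_partition_of_unity_average_approx hR hU hi
    (show 0 < ε * γ ^ 2 / 4 * (ε / 2 * c) by positivity)
  have hpU : ∀ k, p k ∈ U (i (p k)) := fun k => hi _
  set m : Fin N → ℝ := fun k => ∫ z, f k z ∂μ
  set v : Fin N → E := fun k => (m k)⁻¹ • ∫ z, f k z • R z ∂μ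
  set G : X → ℝ := fun x => ∑ k, f k x * ‖v k - R x‖
  have hfi : ∀ k, Integrable (f k) μ := fun k => by
    simpa using (f k).integrable_mul_real (integrable_const (1 : ℝ))
  have hm0 : ∀ k, 0 ≤ m k := fun k => integral_nonneg (hf k)
  have hvint : ∀ k, ‖∫ x, f k x • R x ∂μ‖ ≤ m k := fun k =>
    (norm_integral_le_integral_norm _).trans (integral_mono ((f k).integrable_smul_real hR).norm
      (hfi k) fun x => by
        simpa [norm_smul, abs_of_nonneg (hf k x)] using mul_le_mul_of_nonneg_left (hR1 x) (hf k x))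
  have hv1 : ∀ k, ‖v k‖ ≤ 1 := fun k => by
    rw [norm_smul, norm_inv, Real.norm_of_nonneg (hm0 k), inv_mul_eq_div]
    exact div_le_one_of_le₀ (hvint k) (hm0 k)
  have hvm : ∀ k, ∫ x, f k x • R x ∂μ = m k • v k := fun k => by
    by_cases h : m k = 0
    · rw [h, zero_smul, ← norm_le_zero_iff, ← h]
      exact hvint k
    · exact (smul_inv_smul₀ h _).symm
  have hG0 : ∀ x, 0 ≤ G x := fun x =>
    Finset.sum_nonneg fun k _ => mul_nonneg (hf k x) (norm_nonneg _)
  have hGm : Measurable G := Finset.measurable_sum _ fun k _ =>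
    (f k).continuous.measurable.mul (stronglyMeasurable_const.sub hRm).norm.measurable
  have hGi : Integrable G μ := integrable_finsetSum _ fun k _ =>
    (f k).integrable_mul_real ((integrable_const _).sub hR).norm
  -- The good set, where the averaging error is small relative to `q`. Off `D`, either q < c or G ≥
  -- (ε/2) c; the choice of `c` and Markov's inequality give each case mass at most ε γ²/4.
  set D : Set X := {x | G x ≤ ε / 2 * q x}
  have hD : MeasurableSet D := measurableSet_le hGm (hq.const_mul _)
  have hDc : μ.real Dᶜ ≤ ε / 2 * γ ^ 2 := by
    have h1 : Dᶜ ⊆ {x | q x < c} ∪ {x | ε / 2 * c ≤ G x} := by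
      intro x hx
      by_cases hqx : q x < c
      · exact Or.inl hqx
      · refine Or.inr (le_trans ?_ (not_le.mp (show ¬ G x ≤ ε / 2 * q x from hx)).le)
        exact mul_le_mul_of_nonneg_left (not_lt.mp hqx) (by positivity)
    have h2 := (mul_meas_ge_le_integral_of_nonneg (Filter.Eventually.of_forall hG0) hGi
      (ε / 2 * c)).trans hG
    have h3 : μ.real {x | ε / 2 * c ≤ G x} ≤ ε * γ ^ 2 / 4 := by
      rw [mul_comm] at h2
      exact le_of_mul_le_mul_right h2 (by positivity)
    have h4 := (measureReal_mono h1).trans (measureReal_union_le (μ := μ) _ _)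
    linarith
  set B : Fin N → Set X := fun k => U (i (p k)) ∩ {x | γ ≤ q x}
  have hB : ∀ k, MeasurableSet (B k) := fun k =>
    (hU _).measurableSet.inter (measurableSet_le measurable_const hq)
  set e : Fin N → ℝ := fun k => ∫ x in Dᶜ, f k x ∂μ
  have he0 : ∀ k, 0 ≤ e k := fun k => integral_nonneg (hf k)
  have hem : ∀ k, ∫ x in D, f k x ∂μ + e k = m k := fun k =>
    integral_add_compl hD (hfi k)
  have heB : ∀ k, e k ≠ 0 → γ ≤ μ.real (B k) := by
    intro k hk
    refine hγU _ (hit _) fun h0 => hk ?_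
    have : m k = 0 := by
      refine integral_eq_zero_of_ae ?_
      have : ∀ᵐ x ∂μ, x ∉ U (i (p k)) := measure_eq_zero_iff_ae_notMem.mp h0
      filter_upwards [this] with x hx
      by_contra h
      exact hx (hfs k x h)
    have h1 := hem k
    have h2 : 0 ≤ ∫ x in D, f k x ∂μ := integral_nonneg (hf k)
    linarith [he0 k]
  have hesum : ∑ k, e k ≤ ε / 2 * γ ^ 2 := by
    rw [← integral_finsetSum _ fun k _ => (hfi k).integrableOn]
    simpa [hf1] using hDc
  -- f k is kept on `D`, and its lost mass e k is spread uniformly over B k, the part of the same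
  -- coarse neighbourhood on which q ≥ γ.
  let ρ : Fin N → X → ℝ := fun k x =>
    D.indicator (f k) x + (B k).indicator (fun _ => e k / μ.real (B k)) x
  have hρi : ∀ k, Integrable (ρ k) μ := fun k =>
    ((hfi k).indicator hD).add ((integrable_const _).indicator (hB k))
  refine ⟨N, p, f, ρ, v, hf, hf1, hρi, fun k x => ?_, fun k => ?_, hvm, fun g hg k x hx => ?_,
    fun x => ⟨D.indicator 1 x, ?_, ?_⟩⟩
  · exact add_nonneg (Set.indicator_nonneg (fun x _ => hf k x) x)
      (Set.indicator_nonneg (fun x _ => div_nonneg (he0 k) measureReal_nonneg) x)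
  · change ∫ x, D.indicator (f k) x + (B k).indicator (fun _ => e k / μ.real (B k)) x ∂μ = m k
    rw [integral_add ((hfi k).indicator hD) ((integrable_const _).indicator (hB k)),
      integral_indicator hD, integral_indicator_const _ (hB k), ← hem k, smul_eq_mul]
    congr 1
    by_cases h0 : e k = 0
    · simp [h0]
    · exact mul_div_cancel₀ _ (hγ.trans_le (heB k h0)).ne'
  · refine ⟨hosc _ g hg x (hfs k x hx) _ (hpU k), fun y hy => ?_⟩
    refine hosc _ g hg x (hfs k x hx) y ?_
    by_contra hyU
    refine hy ?_
    have h1 : f k y = 0 := by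
      by_contra h
      exact hyU (hfs k y h)
    have h2 : y ∉ B k := fun h => hyU h.1
    simp only [ρ]
    rw [Set.indicator_of_notMem h2, Set.indicator_apply, h1, ite_self, add_zero]
  · exact Set.indicator_le_self' (f := (1 : X → ℝ)) (fun _ _ => zero_le_one) x
  · have h1 : ∑ k, ρ k x • v k - D.indicator (1 : X → ℝ) x • R x =
        D.indicator (1 : X → ℝ) x • (∑ k, f k x • (v k - R x)) +
          ∑ k, (B k).indicator (fun _ => e k / μ.real (B k)) x • v k := by
      simp only [ρ, add_smul, Finset.sum_add_distrib, smul_sub, Finset.sum_sub_distrib,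
        ← Finset.sum_smul, hf1, one_smul]
      by_cases hx : x ∈ D
      · simp [hx]; abel
      · simp [hx]
    have h2 : ‖D.indicator (1 : X → ℝ) x • (∑ k, f k x • (v k - R x))‖ ≤ ε / 2 * q x := by
      by_cases hx : x ∈ D
      · rw [Set.indicator_of_mem hx, Pi.one_apply, one_smul]
        refine (norm_sum_le _ _).trans (le_trans (Finset.sum_le_sum fun k _ => ?_) hx)
        rw [norm_smul, Real.norm_of_nonneg (hf k x)]
      · rw [Set.indicator_of_notMem hx, zero_smul, norm_zero]
        exact mul_nonneg (by positivity) (hq0 x)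
    -- On B k the added weight is at most e k / γ ≤ e k · q / γ², and the total lost mass is at most
    -- (ε/2) γ², so the sum is at most (ε/2) q.
    have h3 : ∀ k, ‖(B k).indicator (fun _ => e k / μ.real (B k)) x • v k‖ ≤
        e k * (q x / γ ^ 2) := by
      intro k
      have hr : 0 ≤ e k * (q x / γ ^ 2) :=
        mul_nonneg (he0 k) (div_nonneg (hq0 x) (by positivity))
      by_cases hx : x ∈ B k
      · rw [Set.indicator_of_mem hx, norm_smul,
          Real.norm_of_nonneg (div_nonneg (he0 k) measureReal_nonneg)]
        refine (mul_le_of_le_one_right (div_nonneg (he0 k) measureReal_nonneg) (hv1 k)).trans ?_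
        by_cases h0 : e k = 0
        · simp [h0]
        · rw [div_eq_mul_inv]
          refine mul_le_mul_of_nonneg_left ?_ (he0 k)
          calc (μ.real (B k))⁻¹ ≤ γ⁻¹ := inv_anti₀ hγ (heB k h0)
            _ = γ / γ ^ 2 := by field_simp
            _ ≤ q x / γ ^ 2 := by
              have : γ ≤ q x := hx.2
              gcongr
      · rw [Set.indicator_of_notMem hx, zero_smul, norm_zero]
        exact hr
    have h4 : ‖∑ k, (B k).indicator (fun _ => e k / μ.real (B k)) x • v k‖ ≤ ε / 2 * q x :=
      calc _ ≤ ∑ k, e k * (q x / γ ^ 2) :=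
            (norm_sum_le _ _).trans (Finset.sum_le_sum fun k _ => h3 k)
        _ = (∑ k, e k) * (q x / γ ^ 2) := by rw [Finset.sum_mul]
        _ ≤ (ε / 2 * γ ^ 2) * (q x / γ ^ 2) :=
            mul_le_mul_of_nonneg_right hesum (div_nonneg (hq0 x) (by positivity))
        _ = ε / 2 * q x := by field_simp
    rw [h1]
    exact (norm_add_le _ _).trans (by linarith)

end Weights

/-! ### The finite-rank maps and the domination estimate -/

section Approximation

open MeasureTheory

variable {X : Type u} [TopologicalSpace X] [CompactSpace X] {n : ℕ}

/-- Complete positivity specialized to 1 × 1 matrices over the algebra. -/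
theorem MatrixFunctionAlgebra.map_sumSMulRight_nonneg {N : ℕ} {f : Fin N → C(X, ℂ)}
    {ν : Fin N → C(X, ℂ) →ₗ[ℂ] ℂ} (hf : ∀ k, 0 ≤ f k) (hν : ∀ k g, 0 ≤ g → 0 ≤ ν k g)
    {a : MatrixFunctionAlgebra n X} (ha : 0 ≤ a) :
    0 ≤ (a.map (sumSMulRight f ν) : MatrixFunctionAlgebra n X) := by
  obtain ⟨b, rfl⟩ := CStarAlgebra.exists_eq_star_mul_self ha
  let S : CStarMatrix (Fin 1) (Fin 1) (MatrixFunctionAlgebra n X) :=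
    CStarMatrix.ofMatrix fun _ _ => b
  have hS : (star S * S) 0 0 = star b * b := by
    rw [CStarMatrix.mul_apply]
    simp only [Finset.univ_unique, Finset.sum_singleton, CStarMatrix.star_apply]
    rfl
  obtain ⟨T, hT⟩ := CStarMatrix.exists_gram_of_nonneg
    (CStarMatrix.map_sumSMulRight_nonneg hf hν (star_mul_self_nonneg S))
  have := hT 0 0
  rw [CStarMatrix.map_apply, hS] at this
  rw [this]
  exact Finset.sum_nonneg fun c _ => star_mul_self_nonneg _

theorem MatrixFunctionAlgebra.posSemidef_apply {a : MatrixFunctionAlgebra n X} (ha : 0 ≤ a)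
    (x : X) : (Matrix.of fun i j => a i j x).PosSemidef := by
  obtain ⟨b, rfl⟩ := CStarAlgebra.exists_eq_star_mul_self ha
  have : (Matrix.of fun i j => (star b * b) i j x) =
      (Matrix.of fun i j => b i j x).conjTranspose * (Matrix.of fun i j => b i j x) := by
    ext i j
    simp [CStarMatrix.mul_apply, CStarMatrix.star_apply, Matrix.mul_apply]
  rw [this]
  exact Matrix.posSemidef_conjTranspose_mul_self _

/-- Perturbing the density at a point by `w` with `‖w - s • M‖ ≤ δ * det M` increases the pairing
with a positive semidefinite matrix by a factor of at most `1 + n² δ`. -/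
theorem Matrix.PosSemidef.re_sum_mul_le {a M : Matrix (Fin n) (Fin n) ℂ} (ha : a.PosSemidef)
    (h : M.PosSemidef) (htr : M.trace = 1) {w : Fin n → Fin n → ℂ} {s δ : ℝ} (hs : s ≤ 1)
    (hδ : 0 ≤ δ) (hw : ‖w - s • (fun i j => M i j)‖ ≤ δ * M.det.re) :
    (∑ i, ∑ j, a i j * w i j).re ≤ (1 + n ^ 2 * δ) * (∑ i, ∑ j, a i j * M i j).re := by
  have hdet := ha.det_mul_trace_le_sum_mul h htr
  have htr0 : 0 ≤ a.trace.re := (Complex.nonneg_iff.mp ha.trace_nonneg).1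
  have hdet0 : 0 ≤ M.det.re := (Complex.nonneg_iff.mp h.det_nonneg).1
  have hp0 : 0 ≤ (∑ i, ∑ j, a i j * M i j).re := (mul_nonneg hdet0 htr0).trans hdet
  have h1 : ∑ i, ∑ j, a i j * w i j = s * (∑ i, ∑ j, a i j * M i j) +
      ∑ i, ∑ j, a i j * (w - s • (fun i j => M i j)) i j := by
    simp only [Finset.mul_sum, ← Finset.sum_add_distrib]
    refine Finset.sum_congr rfl fun i _ => Finset.sum_congr rfl fun j _ => ?_
    simp only [Pi.sub_apply, Pi.smul_apply, Complex.real_smul]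
    ring
  have h2 : ‖∑ i, ∑ j, a i j * (w - s • (fun i j => M i j)) i j‖ ≤
      n ^ 2 * (a.trace.re * (δ * M.det.re)) := by
    calc _ ≤ ∑ i : Fin n, ∑ j : Fin n, a.trace.re * (δ * M.det.re) := by
          refine norm_sum_le_of_le _ fun i _ => norm_sum_le_of_le _ fun j _ => ?_
          rw [norm_mul]
          exact mul_le_mul (ha.norm_apply_le_trace i j)
            (((norm_le_pi_norm _ j).trans (norm_le_pi_norm _ i)).trans hw) (norm_nonneg _) htr0
      _ = _ := by simp; ring
  rw [h1, Complex.add_re, Complex.re_ofReal_mul]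
  have h3 := (Complex.re_le_norm _).trans h2
  have h4 : s * (∑ i, ∑ j, a i j * M i j).re ≤ 1 * (∑ i, ∑ j, a i j * M i j).re :=
    mul_le_mul_of_nonneg_right hs hp0
  have h5 : (n : ℝ) ^ 2 * (a.trace.re * (δ * M.det.re)) ≤
      n ^ 2 * δ * (∑ i, ∑ j, a i j * M i j).re := by
    calc (n : ℝ) ^ 2 * (a.trace.re * (δ * M.det.re))
        = n ^ 2 * δ * (M.det.re * a.trace.re) := by ring
      _ ≤ _ := mul_le_mul_of_nonneg_left hdet (by positivity)
  linarith

variable [MeasurableSpace X] [BorelSpace X] {μ : Measure X}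

theorem integrable_weight_mul {ρ : X → ℝ} (hρ : Integrable ρ μ) (g : C(X, ℂ)) :
    Integrable (fun x => (ρ x : ℂ) * g x) μ :=
  hρ.ofReal.mul_bdd g.continuous.aestronglyMeasurable
    (Filter.Eventually.of_forall fun x => g.norm_coe_le_norm x)

/-- Integration against an integrable real weight. -/
noncomputable def weightedIntegral {ρ : X → ℝ} (hρ : Integrable ρ μ) :
    C(X, ℂ) →ₗ[ℂ] ℂ where
  toFun g := ∫ x, (ρ x : ℂ) * g x ∂μ
  map_add' g h := by
    rw [← integral_add (integrable_weight_mul hρ g) (integrable_weight_mul hρ h)]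
    simp [mul_add]
  map_smul' c g := by
    simp only [RingHom.id_apply, smul_eq_mul]
    rw [← integral_const_mul]
    congr 1; ext x
    simp only [ContinuousMap.smul_apply, smul_eq_mul]
    ring

/-- The normalized weighted mean, or evaluation at `p` if the weight has mass zero. -/
noncomputable def weightedMean {ρ : X → ℝ} (hρ : Integrable ρ μ) (p : X) : C(X, ℂ) →ₗ[ℂ] ℂ :=
  open Classical in
  if ∫ x, ρ x ∂μ = 0 then (ContinuousMap.evalCLM ℂ p).toLinearMap
  else (((∫ x, ρ x ∂μ)⁻¹ : ℝ) : ℂ) • weightedIntegral hρ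

theorem weightedMean_of_integral_eq_zero {ρ : X → ℝ} (hρ : Integrable ρ μ) (p : X)
    (h : ∫ x, ρ x ∂μ = 0) (g : C(X, ℂ)) : weightedMean hρ p g = g p := by
  rw [weightedMean, if_pos h]
  rfl

theorem weightedMean_of_integral_ne_zero {ρ : X → ℝ} (hρ : Integrable ρ μ) (p : X)
    (h : ∫ x, ρ x ∂μ ≠ 0) (g : C(X, ℂ)) :
    weightedMean hρ p g = (((∫ x, ρ x ∂μ)⁻¹ : ℝ) : ℂ) * ∫ x, (ρ x : ℂ) * g x ∂μ := by
  rw [weightedMean, if_neg h]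
  rfl

/-- If the mass is zero then the weight vanishes almost everywhere, so the default evaluation at `p`
does no harm. -/
theorem integral_mul_weightedMean {ρ : X → ℝ} (hρ : Integrable ρ μ) (hρ0 : ∀ x, 0 ≤ ρ x) (p : X)
    (g : C(X, ℂ)) :
    ((∫ x, ρ x ∂μ : ℝ) : ℂ) * weightedMean hρ p g = ∫ x, (ρ x : ℂ) * g x ∂μ := by
  by_cases h : ∫ x, ρ x ∂μ = 0
  · have h0 := (integral_eq_zero_iff_of_nonneg hρ0 hρ).mp h
    rw [h, Complex.ofReal_zero, zero_mul, eq_comm]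
    refine integral_eq_zero_of_ae ?_
    filter_upwards [h0] with x hx
    simp [hx]
  · rw [weightedMean_of_integral_ne_zero hρ p h, ← mul_assoc, ← Complex.ofReal_mul,
      mul_inv_cancel₀ h, Complex.ofReal_one, one_mul]

theorem weightedMean_nonneg {ρ : X → ℝ} (hρ : Integrable ρ μ) (hρ0 : ∀ x, 0 ≤ ρ x) (p : X)
    {g : C(X, ℂ)} (hg : 0 ≤ g) : 0 ≤ weightedMean hρ p g := by
  have hg' : ∀ x, 0 ≤ g x := fun x => hg x
  by_cases h : ∫ x, ρ x ∂μ = 0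
  · rw [weightedMean_of_integral_eq_zero hρ p h]
    exact hg' p
  · rw [weightedMean_of_integral_ne_zero hρ p h]
    refine mul_nonneg ?_ (integral_nonneg fun x => mul_nonneg ?_ (hg' x))
    · exact Complex.zero_le_real.mpr (inv_nonneg.mpr (integral_nonneg hρ0))
    · exact Complex.zero_le_real.mpr (hρ0 x)

theorem weightedMean_one {ρ : X → ℝ} (hρ : Integrable ρ μ) (p : X) :
    weightedMean hρ p 1 = 1 := by
  by_cases h : ∫ x, ρ x ∂μ = 0
  · rw [weightedMean_of_integral_eq_zero hρ p h]
    rfl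
  · rw [weightedMean_of_integral_ne_zero hρ p h]
    simp only [ContinuousMap.one_apply, mul_one]
    rw [integral_complex_ofReal, ← Complex.ofReal_mul, inv_mul_cancel₀ h, Complex.ofReal_one]

/-- A mean of values in a closed ball stays in the ball; the hypothesis at `p` covers weights of
mass zero. -/
theorem norm_weightedMean_sub_le {ρ : X → ℝ} (hρ : Integrable ρ μ) (hρ0 : ∀ x, 0 ≤ ρ x) {p : X}
    {g : C(X, ℂ)} {z : ℂ} {ε : ℝ} (hp : ‖g p - z‖ ≤ ε) (hg : ∀ y, ρ y ≠ 0 → ‖g y - z‖ ≤ ε) :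
    ‖weightedMean hρ p g - z‖ ≤ ε := by
  by_cases h : ∫ x, ρ x ∂μ = 0
  · rwa [weightedMean_of_integral_eq_zero hρ p h]
  have hm : 0 < ∫ x, ρ x ∂μ := lt_of_le_of_ne (integral_nonneg hρ0) (Ne.symm h)
  have h1 : ((∫ x, ρ x ∂μ : ℝ) : ℂ) * (weightedMean hρ p g - z) =
      ∫ x, (ρ x : ℂ) * (g x - z) ∂μ := by
    have hz : Integrable (fun x => (ρ x : ℂ) * z) μ := hρ.ofReal.mul_const z
    simp only [mul_sub]
    rw [integral_mul_weightedMean hρ hρ0, integral_sub (integrable_weight_mul hρ g) hz,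
      integral_mul_const, integral_complex_ofReal]
  have h2 : (∫ x, ρ x ∂μ) * ‖weightedMean hρ p g - z‖ ≤ (∫ x, ρ x ∂μ) * ε := by
    calc _ = ‖∫ x, (ρ x : ℂ) * (g x - z) ∂μ‖ := by
          rw [← h1, norm_mul, Complex.norm_real, Real.norm_of_nonneg hm.le]
      _ ≤ ∫ x, ρ x * ε ∂μ := by
          refine norm_integral_le_of_norm_le (hρ.mul_const ε)
            (Filter.Eventually.of_forall fun x => ?_)
          rw [norm_mul, Complex.norm_real, Real.norm_of_nonneg (hρ0 x)]
          by_cases h0 : ρ x = 0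
          · simp [h0]
          · exact mul_le_mul_of_nonneg_left (hg x h0) (hρ0 x)
      _ = _ := integral_mul_const _ _
  exact le_of_mul_le_mul_left h2 hm

variable [T2Space X] [μ.Regular] [IsProbabilityMeasure μ]
  {φ : MatrixFunctionAlgebra n X →ₚ[ℂ] ℂ} {r : X → Matrix (Fin n) (Fin n) ℂ}

/-- If the density is almost everywhere invertible, the identity of `C(X)` is approximated by
finite-rank positive unital maps whose amplifications nearly decrease the state. -/
theorem IsDensity.exists_sumSMulRight (h : IsDensity φ μ r) (hdet : ∀ᵐ x ∂μ, (r x).det ≠ 0)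
    (F : Finset C(X, ℂ)) {ε : ℝ} (hε : 0 < ε) (hε1 : ε < 1) :
    ∃ (N : ℕ) (f : Fin N → C(X, ℂ)) (ν : Fin N → C(X, ℂ) →ₗ[ℂ] ℂ),
      (∀ k, 0 ≤ f k) ∧ (∀ k g, 0 ≤ g → 0 ≤ ν k g) ∧ sumSMulRight f ν 1 = 1 ∧
      (∀ g ∈ F, ‖sumSMulRight f ν g - g‖ ≤ ε) ∧
      ∀ a : MatrixFunctionAlgebra n X, 0 ≤ a →
        ((1 - ε : ℝ) : ℂ) * φ (a.map (sumSMulRight f ν)) ≤ φ a := by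
  have hdet0 : ∀ x, 0 ≤ (r x).det := fun x => (h.posSemidef x).det_nonneg
  have hdm : Measurable fun x => (r x).det.re := by
    simp only [Matrix.det_apply]
    exact Complex.measurable_re.comp (Finset.measurable_sum _ fun σ _ =>
      (Finset.measurable_prod _ fun i _ => h.measurable _ _).const_smul _)
  have hpos : ∀ᵐ x ∂μ, 0 < (r x).det.re := by
    filter_upwards [hdet] with x hx
    exact (Complex.pos_iff.mp (lt_of_le_of_ne (hdet0 x) (Ne.symm hx))).1
  let R : X → Fin n → Fin n → ℂ := fun x i j => r x i j
  have hRm : StronglyMeasurable R := Measurable.stronglyMeasurable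
    (measurable_pi_iff.mpr fun i => measurable_pi_iff.mpr fun j => h.measurable i j)
  have hR1 : ∀ x, ‖R x‖ ≤ 1 := fun x => (pi_norm_le_iff_of_nonneg zero_le_one).mpr fun i =>
    (pi_norm_le_iff_of_nonneg zero_le_one).mpr fun j => h.norm_apply_le_one x i j
  have hn : (0 : ℝ) < n ^ 2 + 1 := by positivity
  -- The tolerance ε/(n² + 1) absorbs the factor n² of the entrywise perturbation bound and is
  -- itself at most ε.
  obtain ⟨N, p, f, ρ, v, hf, hf1, hρi, hρ0, hρf, hfv, hosc, hdom⟩ :=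
    exists_partition_of_unity_and_weights (μ := μ) hRm hR1 hdm
      (fun x => (Complex.nonneg_iff.mp (hdet0 x)).1) hpos F (show 0 < ε / (n ^ 2 + 1) by positivity)
  have hεn : ε / (n ^ 2 + 1) ≤ ε := div_le_self hε.le (by nlinarith)
  let fc : Fin N → C(X, ℂ) := fun k => ⟨fun x => (f k x : ℂ), by fun_prop⟩
  let ν : Fin N → C(X, ℂ) →ₗ[ℂ] ℂ := fun k => weightedMean (hρi k) (p k)
  have hfc : ∀ k, 0 ≤ fc k := fun k x => Complex.zero_le_real.mpr (hf k x)
  have hfc1 : ∀ x, ∑ k, fc k x = 1 := fun x => by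
    simp only [fc, ContinuousMap.coe_mk]
    rw [← Complex.ofReal_sum, hf1, Complex.ofReal_one]
  have hν : ∀ k g, 0 ≤ g → 0 ≤ ν k g := fun k g hg => weightedMean_nonneg (hρi k) (hρ0 k) _ hg
  have happ : ∀ g x, sumSMulRight fc ν g x = ∑ k, ν k g * fc k x := fun g x => by
    simp [sumSMulRight_apply]
  refine ⟨N, fc, ν, hfc, hν, ?_, fun g hg => ?_, fun a ha => ?_⟩
  · ext x
    simp only [happ, ν, weightedMean_one, one_mul, hfc1, ContinuousMap.one_apply]
  · rw [ContinuousMap.norm_le _ hε.le]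
    intro x
    have h1 : (sumSMulRight fc ν g - g) x = ∑ k, (fc k x) * (ν k g - g x) := by
      rw [ContinuousMap.sub_apply, happ]
      simp only [mul_sub, Finset.sum_sub_distrib, ← Finset.sum_mul, hfc1, one_mul]
      simp only [mul_comm]
    rw [h1]
    calc _ ≤ ∑ k, f k x * ε := by
          refine norm_sum_le_of_le _ fun k _ => ?_
          rw [norm_mul]
          have h2 : ‖fc k x‖ = f k x := by
            simp only [fc, ContinuousMap.coe_mk]
            rw [Complex.norm_real, Real.norm_of_nonneg (hf k x)]
          rw [h2]
          by_cases h0 : f k x = 0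
          · simp [h0]
          refine mul_le_mul_of_nonneg_left ?_ (hf k x)
          obtain ⟨h3, h4⟩ := hosc g hg k x h0
          exact (norm_weightedMean_sub_le (hρi k) (hρ0 k) h3 h4).trans hεn
      _ = ε := by rw [← Finset.sum_mul, hf1, one_mul]
  · have hPa := map_nonneg φ (MatrixFunctionAlgebra.map_sumSMulRight_nonneg hfc hν ha)
    have ha0 := map_nonneg φ ha
    have hfr : ∀ k i j, ∫ x, fc k x * r x i j ∂μ = ((∫ x, f k x ∂μ : ℝ) : ℂ) * v k i j := by
      intro k i j
      have hi := (f k).integrable_smul_real (μ := μ)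
        (Integrable.of_bound hRm.aestronglyMeasurable 1 (Filter.Eventually.of_forall hR1))
      have h1 := (((ContinuousLinearMap.proj (R := ℝ) (φ := fun _ : Fin n => ℂ) j).comp
        (ContinuousLinearMap.proj (R := ℝ) (φ := fun _ : Fin n => Fin n → ℂ) i))).integral_comp_comm
          hi
      rw [hfv k] at h1
      simpa [R, fc] using h1
    have hterm : ∀ i j k, Integrable (fun x => (ρ k x : ℂ) * a i j x * v k i j) μ := fun i j k =>
      (integrable_weight_mul (hρi k) (a i j)).mul_const _
    have hentry : ∀ i j x, a i j x * (∑ k, ρ k x • v k) i j =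
        ∑ k, (ρ k x : ℂ) * a i j x * v k i j := fun i j x => by
      simp only [Finset.sum_apply, Pi.smul_apply, Complex.real_smul, Finset.mul_sum]
      exact Finset.sum_congr rfl fun k _ => by ring
    have hZ : ∀ i j, Integrable (fun x => a i j x * (∑ k, ρ k x • v k) i j) μ := fun i j => by
      simp only [hentry]
      exact integrable_finsetSum _ fun k _ => hterm i j k
    have hZi : Integrable (fun x => ∑ i, ∑ j, a i j x * (∑ k, ρ k x • v k) i j) μ :=
      integrable_finsetSum _ fun i _ => integrable_finsetSum _ fun j _ => hZ i j
    -- Because ρ k and f k have equal mass, the mass in the integral of f k against the density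
    -- cancels the normalization of the mean.
    have hφP : φ (a.map (sumSMulRight fc ν)) =
        ∫ x, ∑ i, ∑ j, a i j x * (∑ k, ρ k x • v k) i j ∂μ := by
      rw [h.apply_eq, integral_finsetSum _ fun i _ => integrable_finsetSum _ fun j _ => hZ i j]
      refine Finset.sum_congr rfl fun i _ => ?_
      rw [integral_finsetSum _ fun j _ => hZ i j]
      refine Finset.sum_congr rfl fun j _ => ?_
      simp only [hentry]
      rw [integral_finsetSum _ fun k _ => hterm i j k]
      simp only [CStarMatrix.map_apply, happ, Finset.sum_mul, mul_assoc]
      rw [integral_finsetSum _ fun k _ => (h.integrable_mul_apply (fc k) i j).const_mul _]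
      refine Finset.sum_congr rfl fun k _ => ?_
      rw [integral_const_mul, hfr, ← hρf, mul_left_comm, ← mul_assoc,
        integral_mul_weightedMean (hρi k) (hρ0 k), ← integral_mul_const]
      simp only [mul_assoc]
    have hre : (φ (a.map (sumSMulRight fc ν))).re ≤ (1 + ε) * (φ a).re := by
      have h1 : (n : ℝ) ^ 2 * (ε / (n ^ 2 + 1)) ≤ ε := by
        rw [mul_div_assoc', div_le_iff₀ hn]
        nlinarith
      have h2 : (φ (a.map (sumSMulRight fc ν))).re =
          ∫ x, (∑ i, ∑ j, a i j x * (∑ k, ρ k x • v k) i j).re ∂μ := by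
        rw [hφP]
        exact (integral_re hZi).symm
      have h3 : (φ a).re = ∫ x, (densityPairing r a x).re ∂μ := by
        rw [h.apply_eq_integral]
        exact (integral_re (h.integrable_densityPairing a)).symm
      calc _ ≤ ∫ x, (1 + n ^ 2 * (ε / (n ^ 2 + 1))) * (densityPairing r a x).re ∂μ := by
            rw [h2]
            refine integral_mono hZi.re ((h.integrable_densityPairing a).re.const_mul _) fun x => ?_
            obtain ⟨s, hs, hsx⟩ := hdom x
            exact (MatrixFunctionAlgebra.posSemidef_apply ha x).re_sum_mul_le (h.posSemidef x)
              (h.trace_eq_one x) hs (by positivity) hsx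
        _ = (1 + n ^ 2 * (ε / (n ^ 2 + 1))) * (φ a).re := by rw [integral_const_mul, h3]
        _ ≤ _ := mul_le_mul_of_nonneg_right (by linarith) (Complex.nonneg_iff.mp ha0).1
    have ha1 := (Complex.nonneg_iff.mp ha0).1
    rw [Complex.le_def]
    refine ⟨?_, ?_⟩
    -- The two factors combine through (1 - ε)(1 + ε) ≤ 1.
    · rw [Complex.re_ofReal_mul]
      nlinarith [mul_le_mul_of_nonneg_left hre (sub_nonneg.mpr hε1.le),
        mul_nonneg (sq_nonneg ε) ha1]
    · rw [Complex.im_ofReal_mul, ← (Complex.nonneg_iff.mp hPa).2, ← (Complex.nonneg_iff.mp ha0).2,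
        mul_zero]

end Approximation

theorem mainTheorem1 (X : Type u) [TopologicalSpace X] [CompactSpace X] [T2Space X] (n : ℕ)
    (φ : MatrixFunctionAlgebra n X →ₚ[ℂ] ℂ) (hφ : IsState φ) (hfaithful : IsGNSFaithful φ) :
    IsCPApproximable φ := by
  let : MeasurableSpace X := borel X
  have : BorelSpace X := ⟨rfl⟩
  obtain ⟨μ, _, _, r, hr⟩ := hφ.exists_density
  exact isCPApproximable_of_exists_sumSMulRight hφ fun F _ hε hε1 =>
    hr.exists_sumSMulRight (hr.ae_det_ne_zero hfaithful) F hε hε1
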